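/- Setting. Let $n,N,N_y,r,p$ be natural numbers with $N\ge1$. Let $\mathcal G(t)$ be a time-varying undirected simple graph on $\{1,\dots,n\}$, with an arbitrary orientation, oriented incidence matrix $D(t)\in\mathbb R^{n\times n_e(t)}$ ($+1$ at the source and $-1$ at the sink of each edge) and Laplacian $L(t)=D(t)D^\top(t)$. Let $C_i(t)\in\mathbb R^{N_y\times N}$, $i=1,\dots,n$, be regressors; all time-varying data are measurable. Assume that there are constants $T>0$, $\bar\iota_1\ge\underline\iota_1>0$, $r_2>0$, $r_3>0$, $\underline\lambda>0$ such that $$\bar\iota_1I_N\ge\int_{t-T}^t\sum_{i=1}^nC_i^\top(s)C_i(s)\,ds\ge\underline\iota_1I_N\quad(t\ge T),\qquad \|C_i^\top(t)C_i(t)\|\le r_2,\quad \|L(t)\|\le r_3\quad(t\ge0),$$ and for all $t\ge T$ exactly one eigenvalue of $\int_{t-T}^tL(s)\,ds$ (counted with multiplicity) is zero and the others are $\ge\underline\lambda$. Let $\alpha>0$, let $\Gamma_1,\dots,\Gamma_n\in\mathbb R^{N\times N}$ be symmetric positive definite, $\bar\Gamma=\mathrm{diag}(\Gamma_1,\dots,\Gamma_n)$,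 $r_1=\|\bar\Gamma\|$, $r_4=r_2+\alpha r_3$, and $$\bar\Lambda(t)=\begin{bmatrix}\mathrm{diag}(C_1(t),\dots,C_n(t))\\ \sqrt\alpha\,D^\top(t)\otimes I_N\end{bmatrix}.$$ Define $\bar\iota_2=Tr_4$, $$\underline\iota_2=\min_{a\in\mathbb R^N,\ \|a\|^2\le1}\max\Big\{\alpha\underline\lambda(1-\|a\|^2),\ \tfrac{\underline\iota_1}{n}\|a\|^2-2r_2T\sqrt{\|a\|^2(1-\|a\|^2)}\Big\},$$ $\varphi_1=\tfrac12r_1^2\bar\iota_2^2$, $\varphi_2=\tfrac14(e^{2r_1\bar\iota_2}-1)-\tfrac12r_1\bar\iota_2$, $\bar\iota_3=\big(\sqrt{\bar\iota_2-\underline\iota_2+\varphi_2\underline\iota_2}+\sqrt{\bar\iota_2}\big)^2$, and $$\underline\iota_3=\Big(\frac{\sqrt{\bar\iota_2-\underline\iota_2+\varphi_1\underline\iota_2}-\sqrt{\bar\iota_2}}{\varphi_1-1}\Big)^2\ \text{ if }\varphi_1\ne1,\qquad \underline\iota_3=\frac{\underline\iota_2^2}{4\bar\iota_2}\ \text{ if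 }\varphi_1=1.$$ Let $\Delta_1\in\mathbb R^{N\times r}$, $\bar\Delta_1=\mathbf 1_n\otimes\Delta_1$, $\bar\Delta_2\in\mathbb R^{(nN_y+Nn_e(t))\times r}$, $Q^{OE}\in\mathbb R^{p\times(nN_y+Nn_e(t))}$ (the last two may depend on $t$, as their sizes do), and let $W^{OE}\in\mathbb R^{p\times r}$, with $(W^{OE})^\top W^{OE}=I_r$ and $(Q^{OE})^\top W^{OE}=0$. Consider the disturbed error dynamics with performance output $$\dot{\tilde x}=-\bar\Gamma\bar\Lambda^\top(t)\bar\Lambda(t)\tilde x+(\bar\Gamma\bar\Lambda^\top(t)\bar\Delta_2-\bar\Delta_1)\delta(t),\qquad z^{OE}=Q^{OE}\bar\Lambda(t)\tilde x+W^{OE}\delta(t),\qquad t\ge0.$$ Claim. Let $\alpha>0$ be arbitrary (in particular, a maximizer of $\underline\iota_3(\alpha)/\bar\iota_3(\alpha)$) and fix any $c_2>0$. Let $(c_1,\gamma_1,\gamma_2,\gamma)$ be any feasible point (in particular, one with minimal $\gamma$) of the semidefinite program: minimize $\gamma$ subject to $\gamma>0$, $\gamma_1-\gamma_2\ge0$ and,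 for all $t\ge0$, $$\begin{bmatrix}\Phi_{11}^{OE}&\Phi_{12}\\ \Phi_{12}^\top&-\gamma_2I_{nN}\end{bmatrix}\le0,$$ where $$\Phi_{11}^{OE}=\begin{bmatrix}(-c_1+c_2T)I&0&(Q^{OE})^\top&0\\0&-\frac{c_2\underline\iota_3}2I_{nN}&0&0\\Q^{OE}&0&-I_p&W^{OE}\\0&0&(W^{OE})^\top&\phi_{44}\end{bmatrix},\qquad \Phi_{12}=\begin{bmatrix}0\\0\\0\\-\frac{2c_1}{\sqrt{c_2\underline\iota_3}}\bar\Delta_1^\top\end{bmatrix},$$ $$\phi_{44}=\frac{8c_2\bar\iota_3^2}{\underline\iota_3}\bar\Delta_1^\top\bar\Delta_1+\Big(c_1+\frac{8c_2\bar\iota_3^2r_4\gamma_1}{\underline\iota_3}\Big)\bar\Delta_2^\top\bar\Delta_2-\gamma I_r.$$ If $\sqrt{\gamma_1}I_{nN}\ge\bar\Gamma\ge\sqrt{\gamma_2}I_{nN}$, then for every initial state $\tilde x(0)$ and every input $\delta\in\mathcal L_2([0,\infty))$ the system has a (Carathéodory) solution, and the system $\delta\mapsto z^{OE}$ has an $\mathcal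 L_2$-gain of at most $\sqrt\gamma$; that is, the infimum of all $g\ge0$ for which there is $b\ge0$ (depending on $\tilde x(0)$) such that, for all $\delta\in\mathcal L_2([0,\infty))$, $z^{OE}\in\mathcal L_2$ and $\|z^{OE}\|_{\mathcal L_2}\le g\|\delta\|_{\mathcal L_2}+b$, is at most $\sqrt\gamma$. -/

import Mathlib

open MeasureTheory Set
open scoped Matrix Kronecker ENNReal NNReal Matrix.Norms.L2Operator

noncomputable section

namespace ConsInn

/-! ### Signals on `[0, ∞)` and the `L₂`-gain -/

/-- `u ∈ L₂([0,∞))`. -/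
def IsL2 {ι : Type*} [Fintype ι] (u : ℝ → ι → ℝ) : Prop :=
  MemLp u 2 (volume.restrict (Ici (0 : ℝ)))

/-- The `L₂`-norm `(∫₀^∞ u(s)ᵀ u(s) ds)^(1/2)`; it is only used for `u ∈ L₂`. -/
def l2Norm {ι : Type*} [Fintype ι] (u : ℝ → ι → ℝ) : ℝ :=
  Real.sqrt (∫ s in Ici (0 : ℝ), u s ⬝ᵥ u s)

/-- The system with input/output pairs `H` maps `L₂` to `L₂`, with
`‖z‖ ≤ g ‖u‖ + b` for every input `u ∈ L₂` and the corresponding output `z`. -/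
def IsL2GainBound {ι κ : Type*} [Fintype ι] [Fintype κ]
    (H : (ℝ → ι → ℝ) → (ℝ → κ → ℝ) → Prop) (g b : ℝ≥0) : Prop :=
  ∀ u z, IsL2 u → H u z → IsL2 z ∧ l2Norm z ≤ g * l2Norm u + b

/-- The `L₂`-gain: the infimum of all `g ≥ 0` for which some `b ≥ 0` satisfies
`‖z‖ ≤ g ‖u‖ + b`; it is `∞` if there is no such `g`. -/
def l2Gain {ι κ : Type*} [Fintype ι] [Fintype κ]
    (H : (ℝ → ι → ℝ) → (ℝ → κ → ℝ) → Prop) : ℝ≥0∞ :=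
  ⨅ (g : ℝ≥0) (_ : ∃ b : ℝ≥0, IsL2GainBound H g b), (g : ℝ≥0∞)

/-! ### Graph, incidence matrix, Laplacian -/

/-- `E` is an orientation of the undirected graph `G`: each edge of `G` is listed in `E`
exactly once, as a pair (source, sink). -/
structure IsOrientation {n : ℕ} (G : SimpleGraph (Fin n)) (E : Finset (Fin n × Fin n)) :
    Prop where
  adj_iff : ∀ i j, G.Adj i j ↔ (i, j) ∈ E ∨ (j, i) ∈ E
  asymm : ∀ i j, (i, j) ∈ E → (j, i) ∉ E

/-- Oriented incidence matrix: `+1` at the source, `-1` at the sink of an edge. -/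
def incidence {n : ℕ} (E : Finset (Fin n × Fin n)) : Matrix (Fin n) E ℝ :=
  Matrix.of fun i e => if i = e.1.1 then 1 else if i = e.1.2 then -1 else 0

/-- Laplacian `L = D Dᵀ`. -/
def laplacian {n : ℕ} (E : Finset (Fin n × Fin n)) : Matrix (Fin n) (Fin n) ℝ :=
  incidence E * (incidence E)ᵀ

/-- `∫_{t-T}^{t} L(s) ds`. -/
def laplacianIntegral {n : ℕ} (E : ℝ → Finset (Fin n × Fin n)) (T t : ℝ) :
    Matrix (Fin n) (Fin n) ℝ :=
  Matrix.of fun i j => ∫ s in (t - T)..t, laplacian (E s) i j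

theorem laplacianIntegral_isHermitian {n : ℕ} (E : ℝ → Finset (Fin n × Fin n)) (T t : ℝ) :
    (laplacianIntegral E T t).IsHermitian := by
  ext i j
  have h : ∀ s, laplacian (E s) j i = laplacian (E s) i j := fun s => by
    have h2 : (laplacian (E s))ᵀ = laplacian (E s) := by simp [laplacian]
    exact congrFun (congrFun h2 i) j
  simp [laplacianIntegral, h]

/-- `∫_{t-T}^{t} ∑ᵢ Cᵢ(s)ᵀ Cᵢ(s) ds`. -/
def regressorIntegral {n N Ny : ℕ} (C : ℝ → Fin n → Matrix (Fin Ny) (Fin N) ℝ) (T t : ℝ) :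
    Matrix (Fin N) (Fin N) ℝ :=
  Matrix.of fun k l => ∫ s in (t - T)..t, (∑ i, (C s i)ᵀ * C s i) k l

/-! ### Standing assumptions -/

/-- Cooperative persistency of excitation, bounded regressors, and a graph that is bounded and
connected on average, together with measurability of the time-varying data. -/
structure ExcitationAssumption {n N Ny : ℕ}
    (C : ℝ → Fin n → Matrix (Fin Ny) (Fin N) ℝ) (E : ℝ → Finset (Fin n × Fin n))
    (T ι₁u ι₁l r₂ r₃ lam : ℝ) : Prop where
  measurable_C : ∀ i k l, Measurable fun t => C t i k l
  measurable_E : ∀ e, MeasurableSet {t | e ∈ E t}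
  T_pos : 0 < T
  ι₁l_pos : 0 < ι₁l
  ι₁l_le : ι₁l ≤ ι₁u
  cpe_upper : ∀ t, T ≤ t →
    (ι₁u • (1 : Matrix (Fin N) (Fin N) ℝ) - regressorIntegral C T t).PosSemidef
  cpe_lower : ∀ t, T ≤ t →
    (regressorIntegral C T t - ι₁l • (1 : Matrix (Fin N) (Fin N) ℝ)).PosSemidef
  r₂_pos : 0 < r₂
  regressor_bound : ∀ t, 0 ≤ t → ∀ i, ‖(C t i)ᵀ * C t i‖ ≤ r₂
  lam_pos : 0 < lam
  connected_on_average : ∀ t, T ≤ t → ∃ i₀,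
    (laplacianIntegral_isHermitian E T t).eigenvalues i₀ = 0 ∧
    ∀ i, i ≠ i₀ → lam ≤ (laplacianIntegral_isHermitian E T t).eigenvalues i
  r₃_pos : 0 < r₃
  laplacian_bound : ∀ t, 0 ≤ t → ‖laplacian (E t)‖ ≤ r₃

/-! ### Excitation constants -/

/-- Upper bound `ι̅₂ = T r₄`, where `r₄ = r₂ + α r₃`. -/
def iota2Upper (α T r₂ r₃ : ℝ) : ℝ := T * (r₂ + α * r₃)

/-- Lower bound `ι̲₂`, a minimum over the vectors `a ∈ ℝᴺ` with `‖a‖² ≤ 1`. -/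
def iota2Lower (n N : ℕ) (α T ι₁l r₂ lam : ℝ) : ℝ :=
  sInf ((fun a : EuclideanSpace ℝ (Fin N) =>
    max (α * lam * (1 - ‖a‖ ^ 2))
      (ι₁l / n * ‖a‖ ^ 2 - 2 * r₂ * T * Real.sqrt (‖a‖ ^ 2 * (1 - ‖a‖ ^ 2)))) ''
    {a | ‖a‖ ^ 2 ≤ 1})

/-- `φ₁`, as a function of `r₁` and `ι̅₂`. -/
def varphi1 (r₁ ι₂u : ℝ) : ℝ := 1 / 2 * r₁ ^ 2 * ι₂u ^ 2

/-- `φ₂`, as a function of `r₁` and `ι̅₂`. -/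
def varphi2 (r₁ ι₂u : ℝ) : ℝ := 1 / 4 * (Real.exp (2 * r₁ * ι₂u) - 1) - 1 / 2 * r₁ * ι₂u

/-- `ι̅₃`, as a function of `r₁`, `ι̅₂`, `ι̲₂`. -/
def iota3Upper (r₁ ι₂u ι₂l : ℝ) : ℝ :=
  (Real.sqrt (ι₂u - ι₂l + varphi2 r₁ ι₂u * ι₂l) + Real.sqrt ι₂u) ^ 2

/-- `ι̲₃`, as a function of `r₁`, `ι̅₂`, `ι̲₂`; the value at `φ₁ = 1` is the continuous
extension of the general formula. -/
def iota3Lower (r₁ ι₂u ι₂l : ℝ) : ℝ :=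
  if varphi1 r₁ ι₂u = 1 then ι₂l ^ 2 / (4 * ι₂u)
  else ((Real.sqrt (ι₂u - ι₂l + varphi1 r₁ ι₂u * ι₂l) - Real.sqrt ι₂u) /
    (varphi1 r₁ ι₂u - 1)) ^ 2

/-! ### The stacked system -/

/-- Index of the stacked states (agent, component). -/
abbrev StateIdx (n N : ℕ) := Fin n × Fin N

/-- Index of the stacked outputs: local measurements, then the edges with the components of the
differences of the estimates across them. -/
abbrev OutIdx (n N Ny : ℕ) (E : Finset (Fin n × Fin n)) := (Fin n × Fin Ny) ⊕ (E × Fin N)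

/-- `diag(A₁, …, Aₙ)`. -/
def blockDiag {n a b : ℕ} (A : Fin n → Matrix (Fin a) (Fin b) ℝ) :
    Matrix (Fin n × Fin a) (Fin n × Fin b) ℝ :=
  Matrix.of fun x y => if x.1 = y.1 then A x.1 x.2 y.2 else 0

/-- `Λ̄ = [diag(C₁, …, Cₙ) ; √α Dᵀ ⊗ I_N]`. -/
def lambdaBar {n N Ny : ℕ} (α : ℝ) (C : Fin n → Matrix (Fin Ny) (Fin N) ℝ)
    (E : Finset (Fin n × Fin n)) : Matrix (OutIdx n N Ny E) (StateIdx n N) ℝ :=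
  Matrix.fromRows (blockDiag C)
    (Real.sqrt α • ((incidence E)ᵀ ⊗ₖ (1 : Matrix (Fin N) (Fin N) ℝ)))

/-- `1ₙ ⊗ Δ₁`. -/
def deltaBar1 (n : ℕ) {N r : ℕ} (Δ₁ : Matrix (Fin N) (Fin r) ℝ) :
    Matrix (StateIdx n N) (Fin r) ℝ :=
  Matrix.of fun x j => Δ₁ x.2 j

/-- A function on the outputs, extended by zero to the pairs of nodes that are not edges. -/
def extendByZero {n N Ny : ℕ} {E : Finset (Fin n × Fin n)} (f : OutIdx n N Ny E → ℝ) :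
    (Fin n × Fin Ny) ⊕ ((Fin n × Fin n) × Fin N) → ℝ
  | .inl q => f (.inl q)
  | .inr (e, k) => if h : e ∈ E then f (.inr (⟨e, h⟩, k)) else 0

/-- `x` is a (Carathéodory) solution on `[0,∞)` of the disturbed error dynamics
`x' = -Γ̄ Λ̄ᵀ Λ̄ x + (Γ̄ Λ̄ᵀ Δ̄₂ - Δ̄₁) δ`, `x(0) = x₀`. -/
def IsErrorTrajectory {n N Ny r : ℕ} (α : ℝ) (Γ : Fin n → Matrix (Fin N) (Fin N) ℝ)
    (C : ℝ → Fin n → Matrix (Fin Ny) (Fin N) ℝ) (E : ℝ → Finset (Fin n × Fin n))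
    (Δ₁ : Matrix (Fin N) (Fin r) ℝ) (Δ₂ : ∀ t, Matrix (OutIdx n N Ny (E t)) (Fin r) ℝ)
    (x₀ : StateIdx n N → ℝ) (δ : ℝ → Fin r → ℝ) (x : ℝ → StateIdx n N → ℝ) : Prop :=
  let F : ℝ → StateIdx n N → ℝ := fun s =>
    -((blockDiag Γ * (lambdaBar α (C s) (E s))ᵀ * lambdaBar α (C s) (E s)) *ᵥ x s) +
      (blockDiag Γ * (lambdaBar α (C s) (E s))ᵀ * Δ₂ s - deltaBar1 n Δ₁) *ᵥ δ s
  ∀ t, 0 ≤ t → IntervalIntegrable F volume 0 t ∧ x t = x₀ + ∫ s in (0 : ℝ)..t, F s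

/-- Input/output pairs `(δ, z)` of the disturbed error dynamics started at `x₀`, with
performance output `z = Q Λ̄ x + W δ`. -/
def ErrorSystem {n N Ny r p : ℕ} (α : ℝ) (Γ : Fin n → Matrix (Fin N) (Fin N) ℝ)
    (C : ℝ → Fin n → Matrix (Fin Ny) (Fin N) ℝ) (E : ℝ → Finset (Fin n × Fin n))
    (Δ₁ : Matrix (Fin N) (Fin r) ℝ) (Δ₂ : ∀ t, Matrix (OutIdx n N Ny (E t)) (Fin r) ℝ)
    (Q : ∀ t, Matrix (Fin p) (OutIdx n N Ny (E t)) ℝ) (W : Matrix (Fin p) (Fin r) ℝ)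
    (x₀ : StateIdx n N → ℝ) (δ : ℝ → Fin r → ℝ) (z : ℝ → Fin p → ℝ) : Prop :=
  ∃ x, IsErrorTrajectory α Γ C E Δ₁ Δ₂ x₀ δ x ∧
    ∀ t, 0 ≤ t → z t = Q t *ᵥ (lambdaBar α (C t) (E t) *ᵥ x t) + W *ᵥ δ t

/-! ### The linear matrix inequality (at a fixed time) -/

section LMI

variable {n N Ny r p : ℕ} {E : Finset (Fin n × Fin n)}

/-- `φ₄₄`. -/
def phi44 (Δ₁ : Matrix (Fin N) (Fin r) ℝ) (Δ₂ : Matrix (OutIdx n N Ny E) (Fin r) ℝ)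
    (c₁ c₂ γ₁ γ r₄ ι₃u ι₃l : ℝ) : Matrix (Fin r) (Fin r) ℝ :=
  (8 * c₂ * ι₃u ^ 2 / ι₃l) • ((deltaBar1 n Δ₁)ᵀ * deltaBar1 n Δ₁) +
    (c₁ + 8 * c₂ * ι₃u ^ 2 * r₄ * γ₁ / ι₃l) • (Δ₂ᵀ * Δ₂) - γ • 1

/-- `Φ₁₁^OE`, with block rows for `Λ̄x`, `x`, `z`, `δ`. -/
def Phi11OE (Δ₁ : Matrix (Fin N) (Fin r) ℝ) (Δ₂ : Matrix (OutIdx n N Ny E) (Fin r) ℝ)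
    (Q : Matrix (Fin p) (OutIdx n N Ny E) ℝ) (W : Matrix (Fin p) (Fin r) ℝ)
    (T c₁ c₂ γ₁ γ r₄ ι₃u ι₃l : ℝ) :
    Matrix ((OutIdx n N Ny E ⊕ StateIdx n N) ⊕ (Fin p ⊕ Fin r))
      ((OutIdx n N Ny E ⊕ StateIdx n N) ⊕ (Fin p ⊕ Fin r)) ℝ :=
  Matrix.fromBlocks
    (Matrix.fromBlocks ((-c₁ + c₂ * T) • 1) 0
                       0 (-(c₂ * ι₃l / 2) • 1))
    (Matrix.fromBlocks Qᵀ 0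
                       0 0)
    (Matrix.fromBlocks Q 0
                       0 0)
    (Matrix.fromBlocks (-1) W
                       Wᵀ (phi44 Δ₁ Δ₂ c₁ c₂ γ₁ γ r₄ ι₃u ι₃l))

/-- `Φ₁₂`. -/
def Phi12 (n Ny : ℕ) (E : Finset (Fin n × Fin n)) (p : ℕ) (Δ₁ : Matrix (Fin N) (Fin r) ℝ)
    (c₁ c₂ ι₃l : ℝ) :
    Matrix ((OutIdx n N Ny E ⊕ StateIdx n N) ⊕ (Fin p ⊕ Fin r)) (StateIdx n N) ℝ :=
  Matrix.fromRows (Matrix.fromRows 0 0)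
    (Matrix.fromRows 0 (-(2 * c₁ / Real.sqrt (c₂ * ι₃l)) • (deltaBar1 n Δ₁)ᵀ))

/-- The inequality `[Φ₁₁^OE, Φ₁₂; Φ₁₂ᵀ, -γ₂ I] ≤ 0`. -/
def LMIOE (Δ₁ : Matrix (Fin N) (Fin r) ℝ) (Δ₂ : Matrix (OutIdx n N Ny E) (Fin r) ℝ)
    (Q : Matrix (Fin p) (OutIdx n N Ny E) ℝ) (W : Matrix (Fin p) (Fin r) ℝ)
    (T c₁ c₂ γ₁ γ₂ γ r₄ ι₃u ι₃l : ℝ) : Prop :=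
  (-(Matrix.fromBlocks (Phi11OE Δ₁ Δ₂ Q W T c₁ c₂ γ₁ γ r₄ ι₃u ι₃l)
    (Phi12 n Ny E p Δ₁ c₁ c₂ ι₃l)
    (Phi12 n Ny E p Δ₁ c₁ c₂ ι₃l)ᵀ
    (-γ₂ • (1 : Matrix (StateIdx n N) (StateIdx n N) ℝ)))).PosSemidef

end LMI

end ConsInn

end

namespace ConsInn

/-! ### Integrals over intervals -/

/-- Integration by parts for indefinite integrals of real functions. -/
theorem mul_sub_mul_eq_integral {f g u v : ℝ → ℝ} {u₀ v₀ t : ℝ}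
    (hf : IntervalIntegrable f volume 0 t) (hg : IntervalIntegrable g volume 0 t)
    (hu : ∀ s ∈ uIcc 0 t, u s = u₀ + ∫ σ in (0 : ℝ)..s, f σ)
    (hv : ∀ s ∈ uIcc 0 t, v s = v₀ + ∫ σ in (0 : ℝ)..s, g σ) :
    u t * v t - u₀ * v₀ = ∫ s in (0 : ℝ)..t, (f s * v s + u s * g s) := by
  set U : ℝ → ℝ := fun s => u₀ + ∫ σ in (0 : ℝ)..s, f σ with hU
  set V : ℝ → ℝ := fun s => v₀ + ∫ σ in (0 : ℝ)..s, g σ with hV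
  have hac : ∀ (c : ℝ) (h : ℝ → ℝ), IntervalIntegrable h volume 0 t →
      AbsolutelyContinuousOnInterval (fun s => c + ∫ σ in (0 : ℝ)..s, h σ) 0 t := by
    intro c h hh
    have h1 := hh.absolutelyContinuousOnInterval_intervalIntegral (c := 0) left_mem_uIcc
    have h2 : AbsolutelyContinuousOnInterval (fun _ : ℝ => c) 0 t :=
      (contDiffOn_const).absolutelyContinuousOnInterval
    exact h2.add h1
  have hder : ∀ (c : ℝ) (h : ℝ → ℝ), IntervalIntegrable h volume 0 t →
      ∀ᵐ s, s ∈ uIcc 0 t → deriv (fun s => c + ∫ σ in (0 : ℝ)..s, h σ) s = h s := by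
    intro c h hh
    filter_upwards [hh.ae_hasDerivAt_integral] with s hs hs'
    exact ((hs hs' 0 left_mem_uIcc).const_add c).deriv
  have key := (hac u₀ f hf).integral_deriv_mul_eq_sub (hac v₀ g hg)
  rw [hu t right_mem_uIcc, hv t right_mem_uIcc]
  simp only [intervalIntegral.integral_same, add_zero] at key
  rw [← key]
  refine intervalIntegral.integral_congr_ae ?_
  filter_upwards [hder u₀ f hf, hder v₀ g hg] with s h1 h2 hs
  have hs' := uIoc_subset_uIcc hs
  rw [h1 hs', h2 hs', hu s hs', hv s hs']

/-- A moving-window integral of a nonnegative function, integrated in time, is at most the window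
length times the total integral. -/
theorem integral_window_le {f : ℝ → ℝ} {T τ : ℝ} (hT : 0 ≤ T) (hτ : T ≤ τ)
    (hf : IntervalIntegrable f volume 0 τ) (hf0 : ∀ s, 0 ≤ f s) :
    IntervalIntegrable (fun t => ∫ s in (t - T)..t, f s) volume T τ ∧
    ∫ t in T..τ, ∫ s in (t - T)..t, f s ≤ T * ∫ s in (0 : ℝ)..τ, f s := by
  have h0τ : 0 ≤ τ := hT.trans hτ
  set F : ℝ → ℝ := fun t => ∫ s in (0 : ℝ)..t, f s with hF
  have hsub : ∀ a b, 0 ≤ a → a ≤ τ → 0 ≤ b → b ≤ τ → IntervalIntegrable f volume a b := by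
    intro a b ha ha' hb hb'
    refine hf.mono_set ?_
    rw [uIcc_of_le h0τ]
    exact uIcc_subset_Icc ⟨ha, ha'⟩ ⟨hb, hb'⟩
  have hFc : ContinuousOn F (Icc 0 τ) := by
    have := intervalIntegral.continuousOn_primitive_interval' hf left_mem_uIcc
    rwa [uIcc_of_le h0τ] at this
  have hFi : ∀ a b, 0 ≤ a → a ≤ τ → 0 ≤ b → b ≤ τ → IntervalIntegrable F volume a b := by
    intro a b ha ha' hb hb'
    exact (hFc.mono (uIcc_subset_Icc ⟨ha, ha'⟩ ⟨hb, hb'⟩)).intervalIntegrable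
  have hFF : IntervalIntegrable (fun t => F (t - T)) volume T τ := by
    have := (hFi 0 (τ - T) le_rfl h0τ (by linarith) (by linarith)).comp_sub_right T
    simpa using this
  have heq : EqOn (fun t => ∫ s in (t - T)..t, f s) (fun t => F t - F (t - T)) (uIcc T τ) := by
    intro t ht
    rw [uIcc_of_le hτ] at ht
    simp only [hF]
    rw [intervalIntegral.integral_interval_sub_left]
    · exact hsub _ _ le_rfl h0τ (by linarith [ht.1]) ht.2
    · exact hsub _ _ le_rfl h0τ (by linarith [ht.1]) (by linarith [ht.2])
  have hmono : ∀ s ∈ Icc 0 τ, 0 ≤ F s ∧ F s ≤ F τ := by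
    intro s hs
    refine ⟨intervalIntegral.integral_nonneg hs.1 fun _ _ => hf0 _, ?_⟩
    have : F τ - F s = ∫ σ in s..τ, f σ :=
      intervalIntegral.integral_interval_sub_left (hsub _ _ le_rfl h0τ h0τ le_rfl)
        (hsub _ _ le_rfl h0τ hs.1 hs.2)
    have h2 : 0 ≤ ∫ σ in s..τ, f σ := intervalIntegral.integral_nonneg hs.2 fun _ _ => hf0 _
    linarith
  refine ⟨((hFi T τ hT hτ h0τ le_rfl).sub hFF).congr
    (fun t ht => (heq (uIoc_subset_uIcc ht)).symm), ?_⟩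
  rw [intervalIntegral.integral_congr heq,
    intervalIntegral.integral_sub (hFi T τ hT hτ h0τ le_rfl) hFF,
    intervalIntegral.integral_comp_sub_right]
  have e1 : ∫ t in T..τ, F t = (∫ t in (0 : ℝ)..τ, F t) - ∫ t in (0 : ℝ)..T, F t := by
    rw [intervalIntegral.integral_interval_sub_left] <;> apply hFi <;> linarith
  have e2 : (∫ t in (0 : ℝ)..τ, F t) - ∫ t in (0 : ℝ)..(τ - T), F t = ∫ t in (τ - T)..τ, F t := by
    rw [intervalIntegral.integral_interval_sub_left] <;> apply hFi <;> linarith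
  have e3 : 0 ≤ ∫ t in (0 : ℝ)..T, F t :=
    intervalIntegral.integral_nonneg hT fun s hs => (hmono s ⟨hs.1, hs.2.trans hτ⟩).1
  have e4 : ∫ t in (τ - T)..τ, F t ≤ ∫ t in (τ - T)..τ, F τ := by
    refine intervalIntegral.integral_mono_on (by linarith) ?_ (by simp) fun s hs =>
      (hmono s ⟨by linarith [hs.1], hs.2⟩).2
    apply hFi <;> linarith
  simp only [intervalIntegral.integral_const, smul_eq_mul, sub_sub_cancel] at e4
  simp only [sub_self]
  linarith

/-- Cauchy–Schwarz against a constant. -/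
theorem sq_norm_integral_le {H : Type*} [NormedAddCommGroup H] [NormedSpace ℝ H]
    {v : ℝ → H} {a b : ℝ} (hab : a ≤ b) (hv : IntervalIntegrable v volume a b)
    (hv2 : IntervalIntegrable (fun s => ‖v s‖ ^ 2) volume a b) :
    ‖∫ s in a..b, v s‖ ^ 2 ≤ (b - a) * ∫ s in a..b, ‖v s‖ ^ 2 := by
  rcases hab.eq_or_lt with rfl | hlt
  · simp
  have hba : 0 < b - a := sub_pos.2 hlt
  set I := ∫ s in a..b, ‖v s‖ with hI
  set m := I / (b - a) with hm
  have h1 : ‖∫ s in a..b, v s‖ ≤ I := intervalIntegral.norm_integral_le_integral_norm hab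
  have h2 : 0 ≤ ∫ s in a..b, (‖v s‖ ^ 2 - 2 * m * ‖v s‖ + m ^ 2) :=
    intervalIntegral.integral_nonneg hab fun s _ => by nlinarith [sq_nonneg (‖v s‖ - m)]
  rw [intervalIntegral.integral_add (hv2.sub (hv.norm.const_mul _)) (by simp),
    intervalIntegral.integral_sub hv2 (hv.norm.const_mul _),
    intervalIntegral.integral_const_mul, intervalIntegral.integral_const, smul_eq_mul] at h2
  have h3 : m * (b - a) = I := by rw [hm]; field_simp
  have h4 : ‖∫ s in a..b, v s‖ ^ 2 ≤ I ^ 2 := by gcongr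
  rw [← hI] at h2
  have h5 : 0 ≤ (b - a) * ((∫ s in a..b, ‖v s‖ ^ 2) - 2 * m * I + (b - a) * m ^ 2) :=
    mul_nonneg hba.le h2
  have h6 : (b - a) * ((∫ s in a..b, ‖v s‖ ^ 2) - 2 * m * I + (b - a) * m ^ 2) =
      (b - a) * (∫ s in a..b, ‖v s‖ ^ 2) - 2 * (m * (b - a)) * I + (m * (b - a)) ^ 2 := by ring
  rw [h6, h3] at h5
  nlinarith

theorem integral_mono_interval_right {f : ℝ → ℝ} {a b : ℝ} (ha : 0 ≤ a) (hab : a ≤ b)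
    (hf : IntervalIntegrable f volume 0 b) (hf0 : ∀ s, 0 ≤ f s) :
    ∫ s in (0 : ℝ)..a, f s ≤ ∫ s in (0 : ℝ)..b, f s :=
  intervalIntegral.integral_mono_interval le_rfl ha hab (Filter.Eventually.of_forall hf0) hf

/-! ### Indefinite integrals on the half-line -/

section Primitive

variable {H K : Type*} [NormedAddCommGroup H] [NormedAddCommGroup K]
  [NormedSpace ℝ H] [NormedSpace ℝ K]

/-- `x` is the indefinite integral of `f` on `[0, ∞)` with initial value `x₀`. -/
def IsPrimitive (x₀ : H) (f x : ℝ → H) : Prop :=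
  ∀ t, 0 ≤ t → IntervalIntegrable f volume 0 t ∧ x t = x₀ + ∫ s in (0 : ℝ)..t, f s

variable {x₀ y₀ : H} {f g x y : ℝ → H}

theorem IsPrimitive.continuousOn (h : IsPrimitive x₀ f x) {t : ℝ} (ht : 0 ≤ t) :
    ContinuousOn x (Icc 0 t) := by
  have h1 := intervalIntegral.continuousOn_primitive_interval' (h t ht).1 left_mem_uIcc
  rw [uIcc_of_le ht] at h1
  exact (continuousOn_const.add h1).congr fun s hs => (h s hs.1).2

theorem IsPrimitive.sub (hx : IsPrimitive x₀ f x) (hy : IsPrimitive y₀ g y) :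
    IsPrimitive (x₀ - y₀) (fun s => f s - g s) (fun s => x s - y s) := by
  intro t ht
  refine ⟨(hx t ht).1.sub (hy t ht).1, ?_⟩
  dsimp only
  rw [intervalIntegral.integral_sub (hx t ht).1 (hy t ht).1, (hx t ht).2, (hy t ht).2]
  abel

theorem IsPrimitive.congr (hx : IsPrimitive x₀ f x) (hfg : ∀ t, 0 ≤ t → f t = g t) :
    IsPrimitive x₀ g x := by
  intro t ht
  have h : ∀ s ∈ uIoc 0 t, f s = g s := fun s hs => hfg s (by
    rw [uIoc_of_le ht] at hs; exact hs.1.le)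
  refine ⟨(hx t ht).1.congr h, ?_⟩
  rw [(hx t ht).2, intervalIntegral.integral_congr_ae (Filter.Eventually.of_forall h)]

theorem IsPrimitive.map [CompleteSpace H] [CompleteSpace K] (B : H →L[ℝ] K)
    (hx : IsPrimitive x₀ f x) :
    IsPrimitive (B x₀) (fun s => B (f s)) (fun s => B (x s)) := by
  intro t ht
  refine ⟨⟨B.integrable_comp (hx t ht).1.1, B.integrable_comp (hx t ht).1.2⟩, ?_⟩
  dsimp only
  rw [(hx t ht).2, map_add, B.intervalIntegral_comp_comm (hx t ht).1]

theorem IsPrimitive.sub_eq_integral (hx : IsPrimitive x₀ f x) {s t : ℝ} (hs : 0 ≤ s)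
    (ht : 0 ≤ t) : x t - x s = ∫ σ in s..t, f σ := by
  rw [(hx t ht).2, (hx s hs).2, ← intervalIntegral.integral_interval_sub_left (hx t ht).1
    (hx s hs).1]
  abel

end Primitive

theorem IsPrimitive.inner_sub_inner_eq_integral {H : Type*} [NormedAddCommGroup H]
    [InnerProductSpace ℝ H] [FiniteDimensional ℝ H] {x₀ y₀ : H} {f g x y : ℝ → H}
    (hx : IsPrimitive x₀ f x) (hy : IsPrimitive y₀ g y) {t : ℝ} (ht : 0 ≤ t) :
    inner ℝ (x t) (y t) - inner ℝ x₀ y₀ =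
      ∫ s in (0 : ℝ)..t, (inner ℝ (f s) (y s) + inner ℝ (x s) (g s)) := by
  set b := stdOrthonormalBasis ℝ H
  have hsum : ∀ u v : H, inner ℝ u v = ∑ i, inner ℝ (b i) u * inner ℝ (b i) v := fun u v => by
    rw [← b.sum_inner_mul_inner u v]
    exact Finset.sum_congr rfl fun i _ => by rw [real_inner_comm]
  have hX := fun i => hx.map (innerSL ℝ (b i))
  have hY := fun i => hy.map (innerSL ℝ (b i))
  simp only [innerSL_apply_apply] at hX hY
  have hcont : ∀ {z₀ : H} {k z : ℝ → H} (_ : IsPrimitive z₀ k z) i,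
      ContinuousOn (fun s => (inner ℝ (b i) (z s) : ℝ)) (uIcc 0 t) := by
    intro z₀ k z hz i
    rw [uIcc_of_le ht]
    exact continuousOn_const.inner (hz.continuousOn ht)
  have hint : ∀ s, inner ℝ (f s) (y s) + inner ℝ (x s) (g s) =
      ∑ i, (inner ℝ (b i) (f s) * inner ℝ (b i) (y s) +
        inner ℝ (b i) (x s) * inner ℝ (b i) (g s)) := fun s => by
    rw [hsum (f s), hsum (x s), ← Finset.sum_add_distrib]
  rw [hsum (x t), hsum x₀, ← Finset.sum_sub_distrib, funext hint,
    intervalIntegral.integral_finsetSum]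
  · refine Finset.sum_congr rfl fun i _ => ?_
    refine mul_sub_mul_eq_integral (u := fun s => inner ℝ (b i) (x s))
      (v := fun s => inner ℝ (b i) (y s)) (hX i t ht).1 (hY i t ht).1 ?_ ?_
    · intro s hs
      rw [uIcc_of_le ht] at hs
      exact (hX i s hs.1).2
    · intro s hs
      rw [uIcc_of_le ht] at hs
      exact (hY i s hs.1).2
  · intro i _
    exact ((hX i t ht).1.mul_continuousOn (hcont hy i)).add
      ((hY i t ht).1.continuousOn_mul (hcont hx i))

/-! ### Carathéodory solutions of linear differential equations -/

section Existence

variable {H : Type*} [NormedAddCommGroup H] [InnerProductSpace ℝ H]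

theorem IsPrimitive.continuousOn_Ici {x₀ : H} {f x : ℝ → H} (h : IsPrimitive x₀ f x) :
    ContinuousOn x (Ici 0) := by
  intro t ht
  have ht0 : (0 : ℝ) ≤ t := ht
  refine ((h.continuousOn (t := t + 1) (by linarith)) t ⟨ht, by linarith⟩).mono_of_mem_nhdsWithin ?_
  rw [← Ici_inter_Iic]
  exact Filter.inter_mem self_mem_nhdsWithin
    (mem_nhdsWithin_of_mem_nhds (Iic_mem_nhds (by linarith)))

theorem intervalIntegrable_apply_continuousOn {K : Type*} [NormedAddCommGroup K]
    [NormedSpace ℝ K] {A : ℝ → H →L[ℝ] K} (hA : StronglyMeasurable A) {M : ℝ}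
    (hM : ∀ t, 0 ≤ t → ‖A t‖ ≤ M) {y : ℝ → H} {t : ℝ} (ht : 0 ≤ t)
    (hy : ContinuousOn y (Icc 0 t)) :
    IntervalIntegrable (fun s => A s (y s)) volume 0 t := by
  obtain ⟨B, hB⟩ := isCompact_Icc.exists_bound_of_continuousOn hy
  rw [intervalIntegrable_iff_integrableOn_Icc_of_le ht]
  refine (integrable_const (M * B) : Integrable _ (volume.restrict (Icc 0 t))).mono' ?_ ?_
  · exact (ContinuousLinearMap.id ℝ (H →L[ℝ] K)).aestronglyMeasurable_comp₂
      (hA.aestronglyMeasurable (μ := volume.restrict (Icc 0 t)))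
      (hy.aestronglyMeasurable measurableSet_Icc)
  · refine (ae_restrict_iff' measurableSet_Icc).2 (Filter.Eventually.of_forall fun s hs => ?_)
    exact (A s).le_of_opNorm_le_of_le (hM s hs.1) (hB s hs)

/-- A linear differential equation with measurable bounded coefficient and locally integrable
forcing term has a Carathéodory solution on `[0, ∞)`. -/
theorem exists_isPrimitive_linear [CompleteSpace H] {A : ℝ → H →L[ℝ] H}
    (hA : StronglyMeasurable A) {M : ℝ} (hM : ∀ t, 0 ≤ t → ‖A t‖ ≤ M) {f : ℝ → H}
    (hf : ∀ t, 0 ≤ t → IntervalIntegrable f volume 0 t) {B : ℝ}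
    (hfB : ∀ t, 0 ≤ t → ‖∫ s in (0 : ℝ)..t, f s‖ ≤ B * (1 + t)) (x₀ : H) :
    ∃ x, IsPrimitive x₀ (fun s => A s (x s) + f s) x := by
  wlog hM1 : 1 ≤ M generalizing M
  · exact this (M := max M 1) (fun t ht => (hM t ht).trans (le_max_left _ _)) (le_max_right _ _)
  have hB : 0 ≤ B := by simpa using hfB 0 le_rfl
  set E : ℝ → ℝ := fun t => Real.exp (2 * M * t) with hE
  have hEc : Continuous E := by fun_prop
  have hEpos : ∀ t, 0 < E t := fun t => Real.exp_pos _
  have hint : ∀ (y : BoundedContinuousFunction ℝ H) t, 0 ≤ t →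
      IntervalIntegrable (fun s => A s (E s • y s)) volume 0 t := fun y t ht =>
    intervalIntegrable_apply_continuousOn hA hM ht (hEc.smul y.continuous).continuousOn
  have hbound : ∀ (y : BoundedContinuousFunction ℝ H) t, 0 ≤ t →
      ‖∫ s in (0 : ℝ)..t, A s (E s • y s)‖ ≤ E t * (‖y‖ / 2) := by
    intro y t ht
    have h1 : ‖∫ s in (0 : ℝ)..t, A s (E s • y s)‖ ≤ ∫ s in (0 : ℝ)..t, M * ‖y‖ * E s := by
      refine intervalIntegral.norm_integral_le_of_norm_le ht ?_
        ((hEc.const_mul _).intervalIntegrable _ _)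
      refine Filter.Eventually.of_forall fun s hs => ?_
      have h2 : ‖E s • y s‖ ≤ E s * ‖y‖ := by
        rw [norm_smul, Real.norm_of_nonneg (hEpos s).le]
        gcongr
        exact y.norm_coe_le_norm s
      calc ‖A s (E s • y s)‖ ≤ M * (E s * ‖y‖) := (A s).le_of_opNorm_le_of_le (hM s hs.1.le) h2
        _ = _ := by ring
    have h3 : ∫ s in (0 : ℝ)..t, E s = (E t - 1) / (2 * M) := by
      simp only [hE]
      rw [intervalIntegral.integral_comp_mul_left (f := Real.exp) (by positivity)]
      simp [div_eq_inv_mul]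
    rw [intervalIntegral.integral_const_mul, h3] at h1
    refine h1.trans ?_
    have h4 : M * ‖y‖ * ((E t - 1) / (2 * M)) = ‖y‖ / 2 * (E t - 1) := by field_simp
    rw [h4]
    nlinarith [norm_nonneg y]
  set P : BoundedContinuousFunction ℝ H → ℝ → H := fun y t =>
    x₀ + ∫ s in (0 : ℝ)..t, (A s (E s • y s) + f s) with hP
  have hPprim : ∀ y, IsPrimitive x₀ (fun s => A s (E s • y s) + f s) (P y) := fun y t ht =>
    ⟨(hint y t ht).add (hf t ht), rfl⟩
  have hmax : ∀ t : ℝ, 0 ≤ max t 0 := fun t => le_max_right _ _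
  have hΦc : ∀ y, Continuous fun t : ℝ => (E (max t 0))⁻¹ • P y (max t 0) := by
    intro y
    refine Continuous.smul ?_ ?_
    · exact (hEc.comp (by fun_prop)).inv₀ fun t => (hEpos _).ne'
    · exact (hPprim y).continuousOn_Ici.comp_continuous (by fun_prop) hmax
  have hΦb : ∀ y t, ‖(E (max t 0))⁻¹ • P y (max t 0)‖ ≤ ‖x₀‖ + ‖y‖ / 2 + B := by
    intro y t
    set s := max t 0 with hs
    have hs0 : 0 ≤ s := hmax t
    have hE1 : 1 + s ≤ E s := by
      have h1 := Real.add_one_le_exp (2 * M * s)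
      have : s ≤ 2 * M * s := by nlinarith
      simp only [hE]; linarith
    have h2 : ‖P y s‖ ≤ ‖x₀‖ + (E s * (‖y‖ / 2) + B * (1 + s)) := by
      simp only [hP]
      rw [intervalIntegral.integral_add (hint y s hs0) (hf s hs0)]
      exact (norm_add_le _ _).trans (by
        gcongr
        exact (norm_add_le _ _).trans (add_le_add (hbound y s hs0) (hfB s hs0)))
    rw [norm_smul, norm_inv, Real.norm_of_nonneg (hEpos s).le, inv_mul_le_iff₀ (hEpos s)]
    nlinarith [norm_nonneg x₀, norm_nonneg y]
  set Φ : BoundedContinuousFunction ℝ H → BoundedContinuousFunction ℝ H := fun y =>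
    BoundedContinuousFunction.ofNormedAddCommGroup _ (hΦc y) _ (hΦb y) with hΦ
  have hcontr : ContractingWith (1 / 2) Φ := by
    refine ⟨by norm_num, LipschitzWith.of_dist_le_mul fun y z => ?_⟩
    rw [BoundedContinuousFunction.dist_le (by positivity)]
    intro t
    set s := max t 0 with hs
    have hs0 : 0 ≤ s := hmax t
    have h1 : Φ y t - Φ z t = (E s)⁻¹ • ∫ σ in (0 : ℝ)..s, A σ (E σ • (y - z) σ) := by
      change (E s)⁻¹ • P y s - (E s)⁻¹ • P z s = _
      rw [← smul_sub]
      congr 1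
      simp only [hP]
      rw [add_sub_add_left_eq_sub, ← intervalIntegral.integral_sub
        ((hint y s hs0).add (hf s hs0)) ((hint z s hs0).add (hf s hs0))]
      refine intervalIntegral.integral_congr fun σ _ => ?_
      simp [smul_sub]
    rw [dist_eq_norm, h1, norm_smul, norm_inv, Real.norm_of_nonneg (hEpos s).le,
      inv_mul_le_iff₀ (hEpos s)]
    refine (hbound (y - z) s hs0).trans (le_of_eq ?_)
    rw [dist_eq_norm]
    push_cast
    ring
  obtain ⟨y, hy⟩ : ∃ y, Φ y = y := ⟨_, hcontr.fixedPoint_isFixedPt⟩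
  have hx : ∀ t, 0 ≤ t → E t • y t = P y t := by
    intro t ht
    have h1 : Φ y t = (E (max t 0))⁻¹ • P y (max t 0) := rfl
    rw [hy, max_eq_left ht] at h1
    rw [h1, smul_inv_smul₀ (hEpos t).ne']
  exact ⟨fun t => E t • y t, fun t ht => ⟨(hPprim y t ht).1, hx t ht⟩⟩

end Existence

/-! ### Gradient flow with time-varying output map -/

section GradientFlow

variable {H K : Type*} [NormedAddCommGroup H] [NormedAddCommGroup K]
  [InnerProductSpace ℝ H] [InnerProductSpace ℝ K]

/-- The output map `L` is measurable, bounded and persistently exciting over windows of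
length `T`. -/
structure IsPersistentlyExciting (L : ℝ → H →L[ℝ] K) (T r ι : ℝ) : Prop where
  stronglyMeasurable : StronglyMeasurable L
  T_pos : 0 < T
  r_nonneg : 0 ≤ r
  bound : ∀ t, 0 ≤ t → ‖L t‖ ^ 2 ≤ r
  excitation : ∀ t, T ≤ t → ∀ v, ι * ‖v‖ ^ 2 ≤ ∫ s in (t - T)..t, ‖L s v‖ ^ 2

/-- `Γ` is symmetric positive definite with spectrum in `[g, R]` and inverse `G`. -/
structure IsGainPair (Γ G : H →L[ℝ] H) (g R : ℝ) : Prop where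
  left_inv : ∀ v, G (Γ v) = v
  symm : ∀ u v, inner ℝ (G u) v = inner ℝ u (G v)
  norm_le : ‖Γ‖ ≤ R
  lower : ∀ v, g * ‖G v‖ ≤ ‖v‖
  upper : ∀ v, ‖v‖ ^ 2 ≤ R * inner ℝ v (G v)
  nonneg : ∀ v, 0 ≤ inner ℝ v (G v)

theorem _root_.IntervalIntegrable.mono_Icc {E : Type*} [NormedAddCommGroup E] {f : ℝ → E}
    {t a b : ℝ} (hf : IntervalIntegrable f volume 0 t) (ha : 0 ≤ a) (ha' : a ≤ t) (hb : 0 ≤ b)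
    (hb' : b ≤ t) : IntervalIntegrable f volume a b := by
  refine hf.mono_set ?_
  rw [uIcc_of_le (ha.trans ha')]
  exact uIcc_subset_Icc ⟨ha, ha'⟩ ⟨hb, hb'⟩

variable {L : ℝ → H →L[ℝ] K} {Γ G : H →L[ℝ] H} {T r ι g R : ℝ}

theorem IsPersistentlyExciting.norm_le (hL : IsPersistentlyExciting L T r ι) {t : ℝ}
    (ht : 0 ≤ t) : ‖L t‖ ≤ Real.sqrt r :=
  Real.le_sqrt_of_sq_le (hL.bound t ht)

theorem intervalIntegrable_inner_continuousOn {u w : ℝ → H} {t : ℝ} (ht : 0 ≤ t)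
    (hu : ContinuousOn u (Icc 0 t)) (hw : IntervalIntegrable w volume 0 t) :
    IntervalIntegrable (fun s => (inner ℝ (u s) (w s) : ℝ)) volume 0 t := by
  obtain ⟨B, hB⟩ := isCompact_Icc.exists_bound_of_continuousOn hu
  rw [intervalIntegrable_iff_integrableOn_Icc_of_le ht] at hw ⊢
  refine (hw.norm.const_mul B).mono'
    ((hu.aestronglyMeasurable measurableSet_Icc).inner hw.aestronglyMeasurable) ?_
  refine (ae_restrict_iff' measurableSet_Icc).2 (Filter.Eventually.of_forall fun s hs => ?_)
  exact (norm_inner_le_norm _ _).trans (by gcongr; exact hB s hs)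

theorem IsPersistentlyExciting.intervalIntegrable_output (hL : IsPersistentlyExciting L T r ι)
    {x : ℝ → H} {t : ℝ} (ht : 0 ≤ t) (hx : ContinuousOn x (Icc 0 t)) :
    IntervalIntegrable (fun s => L s (x s)) volume 0 t :=
  intervalIntegrable_apply_continuousOn hL.stronglyMeasurable (fun _ h => hL.norm_le h) ht hx

theorem IsPersistentlyExciting.intervalIntegrable_sq_output
    (hL : IsPersistentlyExciting L T r ι) {x : ℝ → H} {t : ℝ} (ht : 0 ≤ t)
    (hx : ContinuousOn x (Icc 0 t)) :
    IntervalIntegrable (fun s => ‖L s (x s)‖ ^ 2) volume 0 t := by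
  obtain ⟨B, hB⟩ := isCompact_Icc.exists_bound_of_continuousOn hx
  have h := hL.intervalIntegrable_output ht hx
  rw [intervalIntegrable_iff_integrableOn_Icc_of_le ht] at h ⊢
  refine (integrable_const ((Real.sqrt r * B) ^ 2) : Integrable _ (volume.restrict (Icc 0 t))).mono'
    (h.aestronglyMeasurable.norm.pow 2) ?_
  refine (ae_restrict_iff' measurableSet_Icc).2 (Filter.Eventually.of_forall fun s hs => ?_)
  rw [norm_pow, norm_norm]
  gcongr
  exact (L s).le_of_opNorm_le_of_le (hL.norm_le hs.1) (hB s hs)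

variable [FiniteDimensional ℝ H] [FiniteDimensional ℝ K]

theorem IsPersistentlyExciting.intervalIntegrable_feedback
    (hL : IsPersistentlyExciting L T r ι) {x : ℝ → H} {t : ℝ} (ht : 0 ≤ t)
    (hx : ContinuousOn x (Icc 0 t)) :
    IntervalIntegrable (fun s => Γ ((L s).adjoint (L s (x s)))) volume 0 t := by
  have hsm : StronglyMeasurable fun s => (L s).adjoint ∘L L s := by
    have h1 : StronglyMeasurable fun s => (L s).adjoint :=
      (ContinuousLinearMap.adjoint (𝕜 := ℝ) (E := H) (F := K)).continuous.comp_stronglyMeasurable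
        hL.stronglyMeasurable
    exact (isBoundedBilinearMap_comp (𝕜 := ℝ) (E := H) (F := K)
      (G := H)).continuous.comp_stronglyMeasurable (h1.prodMk hL.stronglyMeasurable)
  have h := intervalIntegrable_apply_continuousOn (M := r) hsm (fun s hs => by
    rw [ContinuousLinearMap.norm_adjoint_comp_self, ← sq]; exact hL.bound s hs) ht hx
  exact ⟨Γ.integrable_comp h.1, Γ.integrable_comp h.2⟩

/-- Energy balance for the storage function `⟪x, Γ⁻¹ x⟫`. -/
theorem energy_balance (hL : IsPersistentlyExciting L T r ι) (hΓ : IsGainPair Γ G g R)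
    {x₀ : H} {w x : ℝ → H}
    (hw : ∀ t, 0 ≤ t → IntervalIntegrable w volume 0 t)
    (hx : IsPrimitive x₀ (fun s => -Γ ((L s).adjoint (L s (x s))) + w s) x) {t : ℝ} (ht : 0 ≤ t) :
    inner ℝ (x t) (G (x t)) + 2 * ∫ s in (0 : ℝ)..t, ‖L s (x s)‖ ^ 2 =
      inner ℝ x₀ (G x₀) + ∫ s in (0 : ℝ)..t, 2 * inner ℝ (G (x s)) (w s) := by
  have hxc := hx.continuousOn ht
  have h := hx.inner_sub_inner_eq_integral (hx.map G) ht
  have hpt : ∀ s, inner ℝ (-Γ ((L s).adjoint (L s (x s))) + w s) (G (x s)) +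
      inner ℝ (x s) (G (-Γ ((L s).adjoint (L s (x s))) + w s)) =
      2 * inner ℝ (G (x s)) (w s) - 2 * ‖L s (x s)‖ ^ 2 := by
    intro s
    rw [← hΓ.symm (x s), real_inner_comm, inner_add_right, inner_neg_right,
      hΓ.symm (x s) (Γ _), hΓ.left_inv, ContinuousLinearMap.adjoint_inner_right,
      real_inner_self_eq_norm_sq]
    ring
  have hGw : IntervalIntegrable (fun s => (inner ℝ (G (x s)) (w s) : ℝ)) volume 0 t :=
    intervalIntegrable_inner_continuousOn ht (G.continuous.comp_continuousOn hxc) (hw t ht)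
  rw [funext hpt, intervalIntegral.integral_sub (hGw.const_mul 2) ((hL.intervalIntegrable_sq_output ht hxc).const_mul 2),
    intervalIntegral.integral_const_mul 2 (fun s => ‖L s (x s)‖ ^ 2)] at h
  linarith

theorem intervalIntegrable_sq_norm_of_memLp {E : Type*} [NormedAddCommGroup E] {d : ℝ → E}
    (hd : MemLp d 2 (volume.restrict (Ici (0 : ℝ)))) {a b : ℝ} (ha : 0 ≤ a) (hb : 0 ≤ b) :
    IntervalIntegrable (fun s => ‖d s‖ ^ 2) volume a b := by
  have h : IntegrableOn (fun s => ‖d s‖ ^ 2) (Ici (0 : ℝ)) :=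
    (memLp_two_iff_integrable_sq_norm hd.1).1 hd
  rw [intervalIntegrable_iff]
  exact h.mono_set fun s hs => (le_min ha hb).trans hs.1.le

theorem intervalIntegrable_of_memLp {E : Type*} [NormedAddCommGroup E] {d : ℝ → E}
    (hd : MemLp d 2 (volume.restrict (Ici (0 : ℝ)))) {a b : ℝ} (ha : 0 ≤ a) (hb : 0 ≤ b) :
    IntervalIntegrable d volume a b := by
  rw [intervalIntegrable_iff]
  have h1 : MemLp d 2 (volume.restrict (uIoc a b)) :=
    hd.mono_measure (Measure.restrict_mono (fun s hs => (le_min ha hb).trans hs.1.le) le_rfl)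
  have : IsFiniteMeasure (volume.restrict (uIoc a b)) :=
    ⟨by rw [Measure.restrict_apply_univ, uIoc]; exact measure_Ioc_lt_top⟩
  exact h1.integrable (by norm_num)

/-- Measurement disturbances are not amplified. -/
theorem integral_sq_output_le_of_output_disturbance (hL : IsPersistentlyExciting L T r ι)
    (hΓ : IsGainPair Γ G g R) {x₀ : H} {x : ℝ → H} {d : ℝ → K}
    (hd : MemLp d 2 (volume.restrict (Ici (0 : ℝ))))
    (hw : ∀ t, 0 ≤ t → IntervalIntegrable (fun s => Γ ((L s).adjoint (d s))) volume 0 t)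
    (hx : IsPrimitive x₀ (fun s => -Γ ((L s).adjoint (L s (x s))) + Γ ((L s).adjoint (d s))) x)
    {t : ℝ} (ht : 0 ≤ t) :
    ∫ s in (0 : ℝ)..t, ‖L s (x s)‖ ^ 2 ≤
      inner ℝ x₀ (G x₀) + ∫ s in (0 : ℝ)..t, ‖d s‖ ^ 2 := by
  have hxc := hx.continuousOn ht
  have h := energy_balance hL hΓ hw hx ht
  have hy := hL.intervalIntegrable_sq_output ht hxc
  have hd2 := intervalIntegrable_sq_norm_of_memLp hd le_rfl ht
  have h1 : ∫ s in (0 : ℝ)..t, 2 * inner ℝ (G (x s)) (Γ ((L s).adjoint (d s))) ≤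
      ∫ s in (0 : ℝ)..t, (‖L s (x s)‖ ^ 2 + ‖d s‖ ^ 2) := by
    refine intervalIntegral.integral_mono_on ht ?_ (hy.add hd2) fun s _ => ?_
    · exact (intervalIntegrable_inner_continuousOn ht (G.continuous.comp_continuousOn hxc)
        (hw t ht)).const_mul 2
    · rw [hΓ.symm, hΓ.left_inv, ContinuousLinearMap.adjoint_inner_right]
      have h2 := real_inner_le_norm (L s (x s)) (d s)
      nlinarith [sq_nonneg (‖L s (x s)‖ - ‖d s‖)]
  rw [intervalIntegral.integral_add hy hd2] at h1
  linarith [hΓ.nonneg (x t)]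

theorem sq_norm_sub_sub_le {E : Type*} [NormedAddCommGroup E] (a b c : E) {p : ℝ} (hp : 0 < p) :
    ‖a - b - c‖ ^ 2 ≤
      2 * (1 + p) * ‖a‖ ^ 2 + 2 * ((1 + p) / p) * ‖b‖ ^ 2 + 2 * ‖c‖ ^ 2 := by
  have h1 : ‖a - b - c‖ ≤ ‖a‖ + ‖b‖ + ‖c‖ :=
    (norm_sub_le _ _).trans (by gcongr; exact norm_sub_le _ _)
  have h2 : ‖a - b - c‖ ^ 2 ≤ (‖a‖ + ‖b‖ + ‖c‖) ^ 2 := by gcongr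
  have h3 : (1 + p) * ‖a‖ ^ 2 + (1 + p) / p * ‖b‖ ^ 2 - (‖a‖ + ‖b‖) ^ 2 =
      (p * ‖a‖ - ‖b‖) ^ 2 / p := by
    field_simp; ring
  have h4 : 0 ≤ (p * ‖a‖ - ‖b‖) ^ 2 / p := by positivity
  nlinarith [sq_nonneg (‖a‖ + ‖b‖ - ‖c‖)]

/-- Persistency of excitation along a disturbed trajectory. -/
theorem excitation_along_trajectory (hL : IsPersistentlyExciting L T r ι)
    (hΓ : IsGainPair Γ G g R) {x₀ : H} {x d : ℝ → H}
    (hd : MemLp d 2 (volume.restrict (Ici (0 : ℝ))))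
    (hx : IsPrimitive x₀ (fun s => -Γ ((L s).adjoint (L s (x s))) + -d s) x)
    {p : ℝ} (hp : 0 < p) (hpR : p ^ 2 = (R * T * r) ^ 2 / 2) {t : ℝ} (ht : T ≤ t) :
    ι * ‖x t‖ ^ 2 ≤ 2 * (1 + p) ^ 2 * (∫ s in (t - T)..t, ‖L s (x s)‖ ^ 2) +
      r * T ^ 2 * ∫ s in (t - T)..t, ‖d s‖ ^ 2 := by
  have hT := hL.T_pos
  have ht0 : 0 ≤ t := hT.le.trans ht
  have hxc := hx.continuousOn ht0
  have hsub : ∀ {f : ℝ → ℝ} {a b : ℝ},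
      IntervalIntegrable f volume 0 t → t - T ≤ a → a ≤ t → t - T ≤ b → b ≤ t →
      IntervalIntegrable f volume a b := fun hf ha ha' hb hb' =>
    hf.mono_Icc (by linarith) ha' (by linarith) hb'
  have hsubH : ∀ {f : ℝ → H} {a b : ℝ},
      IntervalIntegrable f volume 0 t → t - T ≤ a → a ≤ t → t - T ≤ b → b ≤ t →
      IntervalIntegrable f volume a b := fun hf ha ha' hb hb' =>
    hf.mono_Icc (by linarith) ha' (by linarith) hb'
  have hy2 := hL.intervalIntegrable_sq_output ht0 hxc
  have hd2 := intervalIntegrable_sq_norm_of_memLp hd le_rfl ht0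
  have hd1 := intervalIntegrable_of_memLp hd le_rfl ht0
  have hv1 := hL.intervalIntegrable_feedback (Γ := Γ) ht0 hxc
  set Y := ∫ s in (t - T)..t, ‖L s (x s)‖ ^ 2 with hY
  set D := ∫ s in (t - T)..t, ‖d s‖ ^ 2 with hD
  have hR : 0 ≤ R := (norm_nonneg _).trans hΓ.norm_le
  have htail : ∀ (f : ℝ → ℝ), (∀ σ, 0 ≤ f σ) → IntervalIntegrable f volume 0 t →
      ∀ s ∈ Icc (t - T) t, ∫ σ in s..t, f σ ≤ ∫ σ in (t - T)..t, f σ := by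
    intro f hf0 hf s hs
    exact intervalIntegral.integral_mono_interval hs.1 hs.2 le_rfl
      (Filter.Eventually.of_forall hf0) (hsub hf le_rfl (by linarith) (by linarith) le_rfl)
  have hvle : ∀ σ, 0 ≤ σ → ‖Γ ((L σ).adjoint (L σ (x σ)))‖ ^ 2 ≤
      R ^ 2 * r * ‖L σ (x σ)‖ ^ 2 := by
    intro σ hσ
    have h1 : ‖Γ ((L σ).adjoint (L σ (x σ)))‖ ≤ R * (‖L σ‖ * ‖L σ (x σ)‖) := by
      refine Γ.le_of_opNorm_le_of_le hΓ.norm_le ?_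
      have h2 : ‖(L σ).adjoint‖ = ‖L σ‖ := ContinuousLinearMap.adjoint.norm_map _
      exact h2 ▸ (L σ).adjoint.le_opNorm _
    calc _ ≤ (R * (‖L σ‖ * ‖L σ (x σ)‖)) ^ 2 := by gcongr
      _ = R ^ 2 * ‖L σ‖ ^ 2 * ‖L σ (x σ)‖ ^ 2 := by ring
      _ ≤ _ := by gcongr; exact hL.bound σ hσ
  have hv2 : IntervalIntegrable (fun s => ‖Γ ((L s).adjoint (L s (x s)))‖ ^ 2) volume 0 t := by
    rw [intervalIntegrable_iff_integrableOn_Icc_of_le ht0] at hv1 hy2 ⊢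
    refine (hy2.const_mul (R ^ 2 * r)).mono' (hv1.aestronglyMeasurable.norm.pow 2) ?_
    refine (ae_restrict_iff' measurableSet_Icc).2 (Filter.Eventually.of_forall fun s hs => ?_)
    rw [norm_pow, norm_norm]
    exact hvle s hs.1
  have hvI : ∀ s ∈ Icc (t - T) t, ‖∫ σ in s..t, Γ ((L σ).adjoint (L σ (x σ)))‖ ^ 2 ≤
      (t - s) * (R ^ 2 * r * Y) := by
    intro s hs
    refine (sq_norm_integral_le hs.2 (hsubH hv1 hs.1 hs.2 (by linarith) le_rfl)
      (hsub hv2 hs.1 hs.2 (by linarith) le_rfl)).trans ?_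
    refine mul_le_mul_of_nonneg_left ?_ (sub_nonneg.2 hs.2)
    refine (htail _ (fun _ => sq_nonneg _) hv2 s hs).trans ?_
    rw [hY, ← intervalIntegral.integral_const_mul]
    refine intervalIntegral.integral_mono_on (by linarith)
      (hsub hv2 le_rfl (by linarith) (by linarith) le_rfl)
      ((hsub hy2 le_rfl (by linarith) (by linarith) le_rfl).const_mul _) fun σ hσ =>
        hvle σ (by linarith [hσ.1])
  have hdI : ∀ s ∈ Icc (t - T) t, ‖∫ σ in s..t, d σ‖ ^ 2 ≤ (t - s) * D := by
    intro s hs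
    refine (sq_norm_integral_le hs.2 (hsubH hd1 hs.1 hs.2 (by linarith) le_rfl)
      (hsub hd2 hs.1 hs.2 (by linarith) le_rfl)).trans ?_
    exact mul_le_mul_of_nonneg_left (htail _ (fun _ => sq_nonneg _) hd2 s hs) (sub_nonneg.2 hs.2)
  have hpt : ∀ s ∈ Icc (t - T) t, ‖L s (x t)‖ ^ 2 ≤ 2 * (1 + p) * ‖L s (x s)‖ ^ 2 +
      (2 * ((1 + p) / p) * (r * (R ^ 2 * r * Y)) + 2 * (r * D)) * (t - s) := by
    intro s hs
    have hs0 : 0 ≤ s := by linarith [hs.1]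
    have h1 : x t = x s - (∫ σ in s..t, Γ ((L σ).adjoint (L σ (x σ)))) - ∫ σ in s..t, d σ := by
      have h2 := hx.sub_eq_integral hs0 ht0
      simp only [← neg_add] at h2
      rw [intervalIntegral.integral_neg,
        intervalIntegral.integral_add (hsubH hv1 hs.1 hs.2 (by linarith) le_rfl)
          (hsubH hd1 hs.1 hs.2 (by linarith) le_rfl)] at h2
      rw [sub_eq_iff_eq_add] at h2
      rw [h2]; abel
    have h3 : ∀ (u : H) (c : ℝ), ‖u‖ ^ 2 ≤ (t - s) * c → ‖L s u‖ ^ 2 ≤ r * c * (t - s) := by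
      intro u c hu
      calc ‖L s u‖ ^ 2 ≤ (‖L s‖ * ‖u‖) ^ 2 := by gcongr; exact (L s).le_opNorm u
        _ = ‖L s‖ ^ 2 * ‖u‖ ^ 2 := by ring
        _ ≤ r * ((t - s) * c) := by
          gcongr
          · exact hL.r_nonneg
          · exact hL.bound s hs0
        _ = _ := by ring
    have h4 := h3 _ _ (hvI s hs)
    have h5 := h3 _ _ (hdI s hs)
    rw [h1, map_sub, map_sub]
    refine (sq_norm_sub_sub_le _ _ _ hp).trans ?_
    have h6 : 0 ≤ 2 * ((1 + p) / p) := by positivity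
    have h7 := mul_le_mul_of_nonneg_left h4 h6
    linarith
  have hline : ∫ s in (t - T)..t, (t - s) = T ^ 2 / 2 := by
    rw [intervalIntegral.integral_comp_sub_left (fun s => s)]
    simp
  have hmono : ∫ s in (t - T)..t, ‖L s (x t)‖ ^ 2 ≤ ∫ s in (t - T)..t,
      (2 * (1 + p) * ‖L s (x s)‖ ^ 2 +
      (2 * ((1 + p) / p) * (r * (R ^ 2 * r * Y)) + 2 * (r * D)) * (t - s)) := by
    refine intervalIntegral.integral_mono_on (by linarith) ?_ ?_ hpt
    · exact hsub (hL.intervalIntegrable_sq_output ht0 continuousOn_const) le_rfl (by linarith)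
        (by linarith) le_rfl
    · exact ((hsub hy2 le_rfl (by linarith) (by linarith) le_rfl).const_mul _).add
        ((by fun_prop : Continuous _).intervalIntegrable _ _)
  rw [intervalIntegral.integral_add
    ((hsub hy2 le_rfl (by linarith) (by linarith) le_rfl).const_mul _)
    ((by fun_prop : Continuous _).intervalIntegrable _ _),
    intervalIntegral.integral_const_mul, intervalIntegral.integral_const_mul, hline,
    ← hY] at hmono
  refine (hL.excitation t ht (x t)).trans (hmono.trans (le_of_eq ?_))
  have h8 : r * (R ^ 2 * r * Y) * T ^ 2 = 2 * p ^ 2 * Y := by rw [hpR]; ring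
  have h9 : 2 * ((1 + p) / p) * (p ^ 2 * Y) = 2 * (1 + p) * p * Y := by field_simp
  calc _ = 2 * (1 + p) * Y + 2 * ((1 + p) / p) * (r * (R ^ 2 * r * Y) * T ^ 2 / 2) +
        r * T ^ 2 * D := by ring
    _ = 2 * (1 + p) * Y + 2 * ((1 + p) / p) * (p ^ 2 * Y) + r * T ^ 2 * D := by rw [h8]; ring
    _ = _ := by rw [h9]; ring

end GradientFlow

section GradientFlowGain

variable {H K : Type*} [NormedAddCommGroup H] [NormedAddCommGroup K]
  [InnerProductSpace ℝ H] [InnerProductSpace ℝ K] [FiniteDimensional ℝ H] [FiniteDimensional ℝ K]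
  {L : ℝ → H →L[ℝ] K} {Γ G : H →L[ℝ] H} {T r ι g R : ℝ}

/-- Scalar estimate behind the gain bound: `X`, `Y`, `D` are the squared `L₂`-norms of the state,
the output and the disturbance, and `S` bounds the supplied energy. -/
theorem output_le_of_energy_estimates {X Y D S p : ℝ} (hT : 0 < T) (hι : 0 < ι) (hg : 0 < g)
    (hgR : g ≤ R) (hr : 0 ≤ r) (hιr : ι ≤ T * r) (hp : 0 < p) (hpR : p ^ 2 = (R * T * r) ^ 2 / 2)
    (hX : 0 ≤ X) (hD : 0 ≤ D)
    (hS : T * S = ι / (1 + p) ^ 2 * X / 3 + 3 * (T ^ 2 * (1 + p) ^ 2 / (ι * g ^ 2) * D))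
    (hY : 2 * Y ≤ S)
    (hXS : ι * X ≤ ι * (R * (T * S)) + (1 + p) ^ 2 * (T * S) + r * T ^ 3 * D) :
    Y ≤ 3 * T * (1 + p) ^ 2 / (ι * g ^ 2) * D := by
  have hR : 0 < R := hg.trans_le hgR
  set P := (1 + p) ^ 2 with hP
  have hPp : 0 < P := by positivity
  have hP4 : 4 * p ≤ P := by rw [hP]; nlinarith [sq_nonneg (1 - p)]
  set Z := T ^ 2 * P / (ι * g ^ 2) * D with hZ
  have hZ0 : 0 ≤ Z := by positivity
  set U := ι / P * X with hU
  have hU0 : 0 ≤ U := by positivity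
  set m := R * T * r with hm
  have hm0 : 0 ≤ m := by positivity
  have hmp : m ≤ 1.42 * p := by
    refine abs_le_of_sq_le_sq' ?_ (by positivity) |>.2
    nlinarith
  have hιR : ι * R ≤ 0.36 * P := by
    have h1 : ι * R ≤ m := by rw [hm]; nlinarith
    linarith
  have hrT : r * T ^ 3 * D ≤ P * (0.126 * Z) := by
    have h1 : r * T * (ι * g ^ 2) ≤ 0.126 * P ^ 2 := by
      calc r * T * (ι * g ^ 2) ≤ r * T * (T * r * R ^ 2) := by gcongr
        _ = m ^ 2 := by rw [hm]; ring
        _ = 2 * p ^ 2 := by linarith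
        _ ≤ 0.126 * P ^ 2 := by nlinarith
    have h2 : P * (0.126 * Z) = 0.126 * P ^ 2 * (T ^ 2 * D / (ι * g ^ 2)) := by
      rw [hZ]; ring
    have h3 : r * T ^ 3 * D = r * T * (ι * g ^ 2) * (T ^ 2 * D / (ι * g ^ 2)) := by
      field_simp
    rw [h2, h3]
    gcongr
  have hTS : 0 ≤ T * S := by rw [hS]; positivity
  have hU2 : U ≤ 1.36 * (T * S) + 0.126 * Z := by
    have h1 : P * U = ι * X := by rw [hU]; field_simp
    have h2 : ι * (R * (T * S)) ≤ 0.36 * P * (T * S) := by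
      rw [← mul_assoc]; gcongr
    have h3 : P * U ≤ P * (1.36 * (T * S) + 0.126 * Z) := by
      rw [h1]; nlinarith
    exact le_of_mul_le_mul_left h3 hPp
  have hU9 : U ≤ 9 * Z := by linarith
  have hYZ : T * Y ≤ 3 * Z := by nlinarith
  have h1 : T * (3 * T * P / (ι * g ^ 2) * D) = 3 * Z := by rw [hZ]; ring
  exact le_of_mul_le_mul_left (hYZ.trans h1.ge) hT

/-- Gain of the excited gradient flow from state disturbances to the output. -/
theorem integral_sq_output_le_of_state_disturbance (hL : IsPersistentlyExciting L T r ι)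
    (hΓ : IsGainPair Γ G g R) (hι : 0 < ι) (hιr : ι ≤ T * r) (hg : 0 < g) (hgR : g ≤ R)
    {x d : ℝ → H} (hd : MemLp d 2 (volume.restrict (Ici (0 : ℝ))))
    (hx : IsPrimitive 0 (fun s => -Γ ((L s).adjoint (L s (x s))) + -d s) x)
    {p : ℝ} (hp : 0 < p) (hpR : p ^ 2 = (R * T * r) ^ 2 / 2) {τ : ℝ} (hτ : 0 ≤ τ) :
    ∫ s in (0 : ℝ)..τ, ‖L s (x s)‖ ^ 2 ≤
      3 * T * (1 + p) ^ 2 / (ι * g ^ 2) * ∫ s in (0 : ℝ)..τ, ‖d s‖ ^ 2 := by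
  have hT := hL.T_pos
  have hR : 0 < R := hg.trans_le hgR
  have hxc := hx.continuousOn hτ
  have hy2 := hL.intervalIntegrable_sq_output hτ hxc
  have hd2 := intervalIntegrable_sq_norm_of_memLp hd le_rfl hτ
  have hx2 : IntervalIntegrable (fun s => ‖x s‖ ^ 2) volume 0 τ := by
    refine ContinuousOn.intervalIntegrable ?_
    rw [uIcc_of_le hτ]
    exact hxc.norm.pow 2
  set X := ∫ s in (0 : ℝ)..τ, ‖x s‖ ^ 2 with hX
  set Y := ∫ s in (0 : ℝ)..τ, ‖L s (x s)‖ ^ 2 with hY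
  set D := ∫ s in (0 : ℝ)..τ, ‖d s‖ ^ 2 with hD
  have hX0 : 0 ≤ X := intervalIntegral.integral_nonneg hτ fun _ _ => sq_nonneg _
  have hY0 : 0 ≤ Y := intervalIntegral.integral_nonneg hτ fun _ _ => sq_nonneg _
  have hD0 : 0 ≤ D := intervalIntegral.integral_nonneg hτ fun _ _ => sq_nonneg _
  set ν := ι / (1 + p) ^ 2 * g / (3 * T) with hν
  have hν0 : 0 < ν := by positivity
  set S := 1 / g * (ν * X + 1 / ν * D) with hS
  have henergy : ∀ t ∈ Icc 0 τ,
      inner ℝ (x t) (G (x t)) + 2 * ∫ s in (0 : ℝ)..t, ‖L s (x s)‖ ^ 2 ≤ S := by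
    intro t ht
    have h := energy_balance hL hΓ (fun t ht => (intervalIntegrable_of_memLp hd le_rfl ht).neg)
      hx ht.1
    rw [h, inner_zero_left, zero_add]
    have hint : IntervalIntegrable (fun s => 1 / g * (ν * ‖x s‖ ^ 2 + 1 / ν * ‖d s‖ ^ 2))
        volume 0 τ := ((hx2.const_mul _).add (hd2.const_mul _)).const_mul _
    have h1 : ∫ s in (0 : ℝ)..t, 2 * inner ℝ (G (x s)) ((-d) s) ≤
        ∫ s in (0 : ℝ)..t, 1 / g * (ν * ‖x s‖ ^ 2 + 1 / ν * ‖d s‖ ^ 2) := by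
      have hxt := hx.continuousOn ht.1
      have hi : IntervalIntegrable (fun s => (inner ℝ (G (x s)) ((-d) s) : ℝ)) volume 0 t :=
        intervalIntegrable_inner_continuousOn ht.1 (G.continuous.comp_continuousOn hxt)
          (intervalIntegrable_of_memLp hd le_rfl ht.1).neg
      refine intervalIntegral.integral_mono_on ht.1 (hi.const_mul 2)
        (hint.mono_Icc le_rfl hτ ht.1 ht.2) fun s _ => ?_
      have h2 : inner ℝ (G (x s)) ((-d) s) ≤ ‖G (x s)‖ * ‖d s‖ := by
        simpa using real_inner_le_norm (G (x s)) ((-d) s)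
      have h3 : ‖G (x s)‖ ≤ 1 / g * ‖x s‖ := by
        rw [one_div, le_inv_mul_iff₀ hg]; exact hΓ.lower _
      have h4 : 2 * (‖x s‖ * ‖d s‖) ≤ ν * ‖x s‖ ^ 2 + 1 / ν * ‖d s‖ ^ 2 := by
        have h5 : ν * ‖x s‖ ^ 2 + 1 / ν * ‖d s‖ ^ 2 - 2 * (‖x s‖ * ‖d s‖) =
            (ν * ‖x s‖ - ‖d s‖) ^ 2 / ν := by field_simp; ring
        have h6 : 0 ≤ (ν * ‖x s‖ - ‖d s‖) ^ 2 / ν := by positivity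
        linarith
      calc 2 * inner ℝ (G (x s)) ((-d) s) ≤ 2 * (1 / g * ‖x s‖ * ‖d s‖) := by
            gcongr; exact h2.trans (by gcongr)
        _ = 1 / g * (2 * (‖x s‖ * ‖d s‖)) := by ring
        _ ≤ _ := by gcongr
    have h7 := integral_mono_interval_right ht.1 ht.2 hint fun s => by positivity
    refine h1.trans (h7.trans (le_of_eq ?_))
    rw [intervalIntegral.integral_const_mul, intervalIntegral.integral_add (hx2.const_mul _)
      (hd2.const_mul _), intervalIntegral.integral_const_mul, intervalIntegral.integral_const_mul]
  have hS0 : 0 ≤ S := by positivity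
  have hYS : 2 * Y ≤ S := by
    have := henergy τ ⟨hτ, le_rfl⟩
    linarith [hΓ.nonneg (x τ)]
  have hxS : ∀ t ∈ Icc 0 τ, ‖x t‖ ^ 2 ≤ R * S := by
    intro t ht
    refine (hΓ.upper _).trans ?_
    gcongr
    have h1 : 0 ≤ ∫ s in (0 : ℝ)..t, ‖L s (x s)‖ ^ 2 :=
      intervalIntegral.integral_nonneg ht.1 fun _ _ => sq_nonneg _
    linarith [henergy t ht]
  have hstart : ∀ t ∈ Icc 0 τ, ∫ s in (0 : ℝ)..t, ‖x s‖ ^ 2 ≤ t * (R * S) := by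
    intro t ht
    have h1 : ∫ s in (0 : ℝ)..t, ‖x s‖ ^ 2 ≤ ∫ s in (0 : ℝ)..t, R * S :=
      intervalIntegral.integral_mono_on ht.1 (hx2.mono_Icc le_rfl hτ ht.1 ht.2) (by simp)
        fun s hs => hxS s ⟨hs.1, hs.2.trans ht.2⟩
    rwa [intervalIntegral.integral_const, smul_eq_mul, sub_zero] at h1
  refine output_le_of_energy_estimates (X := X) (S := S) hT hι hg hgR hL.r_nonneg hιr hp hpR
    hX0 hD0 ?_ hYS ?_
  · rw [hS, hν]; field_simp
  · rcases le_total τ T with hτT | hTτ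
    · have h1 : X ≤ T * (R * S) := (hstart τ ⟨hτ, le_rfl⟩).trans (by gcongr)
      have h2 : ι * X ≤ ι * (T * (R * S)) := by gcongr
      have h3 : 0 ≤ (1 + p) ^ 2 * (T * S) := by positivity
      have h4 : 0 ≤ r * T ^ 3 * D := by have := hL.r_nonneg; positivity
      linarith
    · obtain ⟨hwy, hWy⟩ := integral_window_le hT.le hTτ hy2 fun _ => sq_nonneg _
      obtain ⟨hwd, hWd⟩ := integral_window_le hT.le hTτ hd2 fun _ => sq_nonneg _
      have h1 : ∫ t in T..τ, ι * ‖x t‖ ^ 2 ≤ ∫ t in T..τ,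
          (2 * (1 + p) ^ 2 * (∫ s in (t - T)..t, ‖L s (x s)‖ ^ 2) +
          r * T ^ 2 * ∫ s in (t - T)..t, ‖d s‖ ^ 2) :=
        intervalIntegral.integral_mono_on hTτ
          ((hx2.mono_Icc hT.le hTτ hτ le_rfl).const_mul _)
          ((hwy.const_mul _).add (hwd.const_mul _)) fun t ht =>
            excitation_along_trajectory hL hΓ hd hx hp hpR ht.1
      rw [intervalIntegral.integral_add (hwy.const_mul _) (hwd.const_mul _),
        intervalIntegral.integral_const_mul, intervalIntegral.integral_const_mul,
        intervalIntegral.integral_const_mul] at h1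
      have h2 : X - ∫ s in (0 : ℝ)..T, ‖x s‖ ^ 2 = ∫ t in T..τ, ‖x t‖ ^ 2 :=
        intervalIntegral.integral_interval_sub_left hx2 (hx2.mono_Icc le_rfl hτ hT.le hTτ)
      rw [← h2] at h1
      have h3 := hstart T ⟨hT.le, hTτ⟩
      have h4 : 2 * (1 + p) ^ 2 * (∫ t in T..τ, ∫ s in (t - T)..t, ‖L s (x s)‖ ^ 2) ≤
          (1 + p) ^ 2 * (T * S) := by
        calc _ ≤ 2 * (1 + p) ^ 2 * (T * Y) := by gcongr
          _ = (1 + p) ^ 2 * (T * (2 * Y)) := by ring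
          _ ≤ _ := by gcongr
      have h5 : r * T ^ 2 * (∫ t in T..τ, ∫ s in (t - T)..t, ‖d s‖ ^ 2) ≤ r * T ^ 3 * D := by
        have := hL.r_nonneg
        calc _ ≤ r * T ^ 2 * (T * D) := by gcongr
          _ = _ := by ring
      have h6 := mul_le_mul_of_nonneg_left h3 hι.le
      linarith

theorem IsPersistentlyExciting.memLp_feedback (hL : IsPersistentlyExciting L T r ι)
    (Γ : H →L[ℝ] H) {d : ℝ → K} (hd : MemLp d 2 (volume.restrict (Ici (0 : ℝ)))) :
    MemLp (fun s => Γ ((L s).adjoint (d s))) 2 (volume.restrict (Ici (0 : ℝ))) := by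
  have h1 : StronglyMeasurable fun s => (L s).adjoint :=
    (ContinuousLinearMap.adjoint (𝕜 := ℝ) (E := H) (F := K)).continuous.comp_stronglyMeasurable
      hL.stronglyMeasurable
  have h2 : AEStronglyMeasurable (fun s => (L s).adjoint (d s)) (volume.restrict (Ici (0 : ℝ))) :=
    (ContinuousLinearMap.id ℝ (K →L[ℝ] H)).aestronglyMeasurable_comp₂
      h1.aestronglyMeasurable hd.1
  refine hd.of_le_mul (c := ‖Γ‖ * Real.sqrt r) (Γ.continuous.comp_aestronglyMeasurable h2) ?_
  refine (ae_restrict_iff' measurableSet_Ici).2 (Filter.Eventually.of_forall fun s hs => ?_)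
  have h3 : ‖(L s).adjoint‖ ≤ Real.sqrt r :=
    (ContinuousLinearMap.adjoint.norm_map (L s)).le.trans (hL.norm_le hs)
  calc ‖Γ ((L s).adjoint (d s))‖ ≤ ‖Γ‖ * (Real.sqrt r * ‖d s‖) :=
        Γ.le_of_opNorm_le_of_le le_rfl ((L s).adjoint.le_of_opNorm_le h3 _)
    _ = _ := by ring

/-- Existence of trajectories under square-integrable forcing. -/
theorem IsPersistentlyExciting.exists_isPrimitive (hL : IsPersistentlyExciting L T r ι)
    (Γ : H →L[ℝ] H) {f : ℝ → H} (hf : MemLp f 2 (volume.restrict (Ici (0 : ℝ)))) (x₀ : H) :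
    ∃ x, IsPrimitive x₀ (fun s => -Γ ((L s).adjoint (L s (x s))) + f s) x := by
  have h1 : StronglyMeasurable fun s => (L s).adjoint :=
    (ContinuousLinearMap.adjoint (𝕜 := ℝ) (E := H) (F := K)).continuous.comp_stronglyMeasurable
      hL.stronglyMeasurable
  have h2 : StronglyMeasurable fun s => (L s).adjoint ∘L L s :=
    (isBoundedBilinearMap_comp (𝕜 := ℝ) (E := H) (F := K)
      (G := H)).continuous.comp_stronglyMeasurable (h1.prodMk hL.stronglyMeasurable)
  have h3 : StronglyMeasurable fun s => -(Γ ∘L ((L s).adjoint ∘L L s)) :=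
    ((ContinuousLinearMap.compL ℝ H H H Γ).continuous.comp_stronglyMeasurable h2).neg
  have hf2 : Integrable (fun s => ‖f s‖ ^ 2) (volume.restrict (Ici (0 : ℝ))) :=
    (memLp_two_iff_integrable_sq_norm hf.1).1 hf
  set F := ∫ s in Ici (0 : ℝ), ‖f s‖ ^ 2 with hF
  have hF0 : 0 ≤ F := integral_nonneg fun _ => sq_nonneg _
  refine exists_isPrimitive_linear (M := ‖Γ‖ * r) (B := 1 + F) h3 (fun t ht => ?_)
    (fun t ht => intervalIntegrable_of_memLp hf le_rfl ht) (fun t ht => ?_) x₀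
  · rw [norm_neg]
    refine (ContinuousLinearMap.opNorm_comp_le _ _).trans ?_
    rw [ContinuousLinearMap.norm_adjoint_comp_self, ← sq]
    gcongr
    exact hL.bound t ht
  · have h4 := sq_norm_integral_le ht (intervalIntegrable_of_memLp hf le_rfl ht)
      (intervalIntegrable_sq_norm_of_memLp hf le_rfl ht)
    have h5 : ∫ s in (0 : ℝ)..t, ‖f s‖ ^ 2 ≤ F := by
      rw [intervalIntegral.integral_of_le ht]
      exact setIntegral_mono_set hf2 (Filter.Eventually.of_forall fun _ => sq_nonneg _)
        (Filter.Eventually.of_forall fun s hs => (hs.1.le : (0 : ℝ) ≤ s))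
    refine abs_le_of_sq_le_sq' ?_ (by positivity) |>.2
    rw [sub_zero] at h4
    have h6 := mul_le_mul_of_nonneg_left h5 ht
    nlinarith [mul_nonneg ht hF0, mul_nonneg (mul_nonneg ht hF0) ht,
      mul_nonneg (mul_nonneg ht hF0) hF0, mul_nonneg (mul_nonneg (mul_nonneg ht hF0) ht) hF0]

/-- Gain of the excited gradient flow under simultaneous state and output disturbances. -/
theorem integral_sq_output_le (hL : IsPersistentlyExciting L T r ι)
    (hΓ : IsGainPair Γ G g R) (hι : 0 < ι) (hιr : ι ≤ T * r) (hg : 0 < g) (hgR : g ≤ R)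
    {x₀ : H} {x d₁ : ℝ → H} {d₂ : ℝ → K} (hd₁ : MemLp d₁ 2 (volume.restrict (Ici (0 : ℝ))))
    (hd₂ : MemLp d₂ 2 (volume.restrict (Ici (0 : ℝ))))
    (hx : IsPrimitive x₀ (fun s => -Γ ((L s).adjoint (L s (x s))) +
      (Γ ((L s).adjoint (d₂ s)) - d₁ s)) x)
    {p : ℝ} (hp : 0 < p) (hpR : p ^ 2 = (R * T * r) ^ 2 / 2) {q c : ℝ} (hq : 0 ≤ q) (hc : 0 < c)
    {τ : ℝ} (hτ : 0 ≤ τ) :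
    q * ∫ s in (0 : ℝ)..τ, ‖L s (x s)‖ ^ 2 ≤ (q + c) * inner ℝ x₀ (G x₀) +
      ((q + c) * (∫ s in (0 : ℝ)..τ, ‖d₂ s‖ ^ 2) +
      q * (q + c) / c * (3 * T * (1 + p) ^ 2 / (ι * g ^ 2)) * ∫ s in (0 : ℝ)..τ, ‖d₁ s‖ ^ 2) := by
  have hf := hL.memLp_feedback Γ hd₂
  obtain ⟨xa, hxa⟩ := hL.exists_isPrimitive Γ hf x₀
  have hxb : IsPrimitive 0 (fun s => -Γ ((L s).adjoint (L s (x s - xa s))) + -d₁ s)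
      (fun s => x s - xa s) := by
    have h1 := hx.sub hxa
    rw [sub_self] at h1
    refine h1.congr fun s _ => ?_
    simp only [map_sub]
    abel
  have ha := integral_sq_output_le_of_output_disturbance hL hΓ hd₂
    (fun t ht => intervalIntegrable_of_memLp hf le_rfl ht) hxa hτ
  have hb := integral_sq_output_le_of_state_disturbance hL hΓ hι hιr hg hgR hd₁ hxb hp hpR hτ
  have hia := hL.intervalIntegrable_sq_output hτ (hxa.continuousOn hτ)
  have hib := hL.intervalIntegrable_sq_output hτ (hxb.continuousOn hτ)
  have hi := hL.intervalIntegrable_sq_output hτ (hx.continuousOn hτ)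
  have hsum : q * ∫ s in (0 : ℝ)..τ, ‖L s (x s)‖ ^ 2 ≤
      (q + c) * (∫ s in (0 : ℝ)..τ, ‖L s (xa s)‖ ^ 2) +
        q * (q + c) / c * ∫ s in (0 : ℝ)..τ, ‖L s (x s - xa s)‖ ^ 2 := by
    rw [← intervalIntegral.integral_const_mul, ← intervalIntegral.integral_const_mul,
      ← intervalIntegral.integral_const_mul,
      ← intervalIntegral.integral_add (hia.const_mul _) (hib.const_mul _)]
    refine intervalIntegral.integral_mono_on hτ (hi.const_mul _)
      ((hia.const_mul _).add (hib.const_mul _)) fun s _ => ?_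
    set u := L s (xa s) with hu
    set v := L s (x s - xa s) with hv
    have h1 : L s (x s) = u + v := by rw [hu, hv, ← map_add]; congr 1; abel
    have h2 : ‖L s (x s)‖ ^ 2 ≤ (‖u‖ + ‖v‖) ^ 2 := by
      rw [h1]; gcongr; exact norm_add_le _ _
    have h3 : (q + c) * ‖u‖ ^ 2 + q * (q + c) / c * ‖v‖ ^ 2 - q * (‖u‖ + ‖v‖) ^ 2 =
        (c * ‖u‖ - q * ‖v‖) ^ 2 / c := by field_simp; ring
    have h4 : 0 ≤ (c * ‖u‖ - q * ‖v‖) ^ 2 / c := by positivity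
    have h5 := mul_le_mul_of_nonneg_left h2 hq
    linarith
  have h1 := mul_le_mul_of_nonneg_left ha (by positivity : 0 ≤ q + c)
  have h2 := mul_le_mul_of_nonneg_left hb (by positivity : 0 ≤ q * (q + c) / c)
  linarith

end GradientFlowGain

/-! ### Gain operators -/

section Gain

variable {H : Type*} [NormedAddCommGroup H] [InnerProductSpace ℝ H]

/-- A symmetric positive definite operator has an inverse that makes it a gain pair. -/
theorem exists_isGainPair [FiniteDimensional ℝ H] [Nontrivial H] {Γ : H →L[ℝ] H}
    (hs : ∀ u v, inner ℝ (Γ u) v = inner ℝ u (Γ v)) (hpos : ∀ u, u ≠ 0 → 0 < inner ℝ u (Γ u)) :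
    ∃ G : H →L[ℝ] H, (∃ g, 0 < g ∧ ∀ u, g * ‖u‖ ≤ ‖Γ u‖) ∧
      ∀ g, (∀ u, g * ‖u‖ ≤ ‖Γ u‖) → g ≤ ‖Γ‖ ∧ IsGainPair Γ G g ‖Γ‖ := by
  have hnn : ∀ u, 0 ≤ inner ℝ u (Γ u) := fun u => by
    rcases eq_or_ne u 0 with rfl | hu
    · simp
    · exact (hpos u hu).le
  have hinj : Function.Injective (Γ : H →ₗ[ℝ] H) := by
    rw [injective_iff_map_eq_zero]
    intro u hu
    by_contra hne
    have := hpos u hne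
    have hu' : Γ u = 0 := hu
    rw [hu', inner_zero_right] at this
    exact this.false
  set e := LinearEquiv.ofInjectiveEndo (Γ : H →ₗ[ℝ] H) hinj with he
  set G : H →L[ℝ] H := (e.symm : H →ₗ[ℝ] H).toContinuousLinearMap with hG
  have hGΓ : ∀ v, G (Γ v) = v := fun v => e.symm_apply_apply v
  have hΓG : ∀ v, Γ (G v) = v := fun v => e.apply_symm_apply v
  have hpsd : ∀ u, ‖Γ u‖ ^ 2 ≤ ‖Γ‖ * inner ℝ (Γ u) u := by
    intro u
    obtain ⟨z, hz⟩ := exists_ne (0 : H)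
    have hR : 0 < ‖Γ‖ := by
      rw [norm_pos_iff]
      rintro rfl
      simpa using hpos z hz
    have h1 := hnn (u - (1 / ‖Γ‖) • Γ u)
    rw [map_sub, map_smul, inner_sub_left, inner_sub_right, inner_sub_right, inner_smul_left,
      inner_smul_right, inner_smul_left, inner_smul_right, ← hs u (Γ u), ← hs u u,
      real_inner_self_eq_norm_sq, conj_trivial] at h1
    have h2 : inner ℝ (Γ u) (Γ (Γ u)) ≤ ‖Γ‖ * ‖Γ u‖ ^ 2 := by
      refine (real_inner_le_norm _ _).trans ?_
      calc ‖Γ u‖ * ‖Γ (Γ u)‖ ≤ ‖Γ u‖ * (‖Γ‖ * ‖Γ u‖) := by gcongr; exact Γ.le_opNorm _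
        _ = _ := by ring
    have h3 : 1 / ‖Γ‖ * (1 / ‖Γ‖ * inner ℝ (Γ u) (Γ (Γ u))) ≤ 1 / ‖Γ‖ * ‖Γ u‖ ^ 2 := by
      have h4 : 1 / ‖Γ‖ * inner ℝ (Γ u) (Γ (Γ u)) ≤ ‖Γ u‖ ^ 2 := by
        rw [one_div, inv_mul_le_iff₀ hR]; exact h2
      gcongr
    have h5 : 1 / ‖Γ‖ * ‖Γ u‖ ^ 2 ≤ inner ℝ (Γ u) u := by linarith
    rwa [one_div, inv_mul_le_iff₀ hR] at h5
  refine ⟨G, ⟨1 / (‖G‖ + 1), by positivity, fun u => ?_⟩, fun g hg => ⟨?_, ?_⟩⟩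
  · rw [one_div, inv_mul_le_iff₀ (by positivity)]
    calc ‖u‖ = ‖G (Γ u)‖ := by rw [hGΓ]
      _ ≤ ‖G‖ * ‖Γ u‖ := G.le_opNorm _
      _ ≤ _ := by gcongr; linarith
  · obtain ⟨z, hz⟩ := exists_ne (0 : H)
    exact le_of_mul_le_mul_right ((hg z).trans (Γ.le_opNorm z)) (norm_pos_iff.2 hz)
  · refine ⟨hGΓ, fun u v => ?_, le_rfl, fun v => ?_, fun v => ?_, fun v => ?_⟩
    · rw [← hΓG v, hGΓ, ← hs, hΓG]
    · simpa [hΓG] using hg (G v)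
    · simpa [hΓG] using hpsd (G v)
    · have := hnn (G v)
      rwa [hΓG, real_inner_comm] at this

theorem IsPersistentlyExciting.le_mul [Nontrivial H] {K : Type*} [NormedAddCommGroup K]
    [InnerProductSpace ℝ K] {L : ℝ → H →L[ℝ] K} {T r ι : ℝ}
    (hL : IsPersistentlyExciting L T r ι) : ι ≤ T * r := by
  obtain ⟨z, hz⟩ := exists_ne (0 : H)
  have hT := hL.T_pos
  have h1 := hL.excitation T le_rfl z
  rw [sub_self] at h1
  have h2 : ∫ s in (0 : ℝ)..T, ‖L s z‖ ^ 2 ≤ ∫ s in (0 : ℝ)..T, r * ‖z‖ ^ 2 := by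
    refine intervalIntegral.integral_mono_on hT.le
      (hL.intervalIntegrable_sq_output hT.le continuousOn_const) (by simp) fun s hs => ?_
    calc ‖L s z‖ ^ 2 ≤ (‖L s‖ * ‖z‖) ^ 2 := by gcongr; exact (L s).le_opNorm z
      _ = ‖L s‖ ^ 2 * ‖z‖ ^ 2 := by ring
      _ ≤ _ := by gcongr; exact hL.bound s hs.1
  rw [intervalIntegral.integral_const, sub_zero, smul_eq_mul, ← mul_assoc] at h2
  exact le_of_mul_le_mul_right (h1.trans h2) (by positivity)

end Gain

/-! ### Excitation constants -/

theorem iota3Lower_eq {r₁ u l : ℝ} (hl : 0 < l) (hlu : l ≤ u) :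
    iota3Lower r₁ u l =
      (l / (Real.sqrt (u - l + varphi1 r₁ u * l) + Real.sqrt u)) ^ 2 := by
  have hu : 0 < u := hl.trans_le hlu
  have hφ : 0 ≤ varphi1 r₁ u := by unfold varphi1; positivity
  have hw : 0 ≤ u - l + varphi1 r₁ u * l := by nlinarith
  unfold iota3Lower
  split_ifs with h
  · rw [h, one_mul, sub_add_cancel, div_pow, ← two_mul, mul_pow, Real.sq_sqrt hu.le]
    norm_num
  · congr 1
    have h1 : varphi1 r₁ u - 1 ≠ 0 := sub_ne_zero.2 h
    have h2 : 0 < Real.sqrt (u - l + varphi1 r₁ u * l) + Real.sqrt u := by positivity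
    rw [div_eq_div_iff h1 h2.ne']
    have h3 := Real.sq_sqrt hw
    have h4 := Real.sq_sqrt hu.le
    nlinarith

theorem iota3Lower_pos {r₁ u l : ℝ} (hl : 0 < l) (hlu : l ≤ u) : 0 < iota3Lower r₁ u l := by
  rw [iota3Lower_eq hl hlu]
  have hu : 0 < u := hl.trans_le hlu
  positivity

theorem iota3Lower_le {r₁ u l p : ℝ} (hl : 0 < l) (hlu : l ≤ u) (hp : 0 ≤ p)
    (hpφ : p ^ 2 = varphi1 r₁ u) : iota3Lower r₁ u l ≤ l / (1 + p) ^ 2 := by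
  rw [iota3Lower_eq hl hlu, ← hpφ]
  have h1 : (1 + p) * Real.sqrt l ≤ Real.sqrt (u - l + p ^ 2 * l) + Real.sqrt u := by
    have h2 : p * Real.sqrt l ≤ Real.sqrt (u - l + p ^ 2 * l) := by
      refine Real.le_sqrt_of_sq_le ?_
      rw [mul_pow, Real.sq_sqrt hl.le]
      linarith
    have h3 : Real.sqrt l ≤ Real.sqrt u := Real.sqrt_le_sqrt hlu
    linarith
  have h4 : 0 < Real.sqrt l := Real.sqrt_pos.2 hl
  calc (l / (Real.sqrt (u - l + p ^ 2 * l) + Real.sqrt u)) ^ 2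
      ≤ (l / ((1 + p) * Real.sqrt l)) ^ 2 := by gcongr
    _ = l / (1 + p) ^ 2 := by
      rw [div_pow, mul_pow, Real.sq_sqrt hl.le]
      field_simp

theorem iota2Lower_le_max {n N : ℕ} {α T ι₁l r₂ lam : ℝ} (hαl : 0 ≤ α * lam)
    {a : EuclideanSpace ℝ (Fin N)} (ha : ‖a‖ ^ 2 ≤ 1) :
    iota2Lower n N α T ι₁l r₂ lam ≤ max (α * lam * (1 - ‖a‖ ^ 2))
      (ι₁l / n * ‖a‖ ^ 2 - 2 * r₂ * T * Real.sqrt (‖a‖ ^ 2 * (1 - ‖a‖ ^ 2))) := by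
  refine csInf_le ⟨0, ?_⟩ ⟨a, ha, rfl⟩
  rintro _ ⟨b, hb, rfl⟩
  exact le_max_of_le_left (mul_nonneg hαl (sub_nonneg.2 hb))

theorem iota2Lower_pos {n N : ℕ} (hn : 0 < n) {α T ι₁l r₂ lam : ℝ} (hα : 0 < α)
    (hlam : 0 < lam) (hι : 0 < ι₁l) : 0 < iota2Lower n N α T ι₁l r₂ lam := by
  have hK : IsCompact {a : EuclideanSpace ℝ (Fin N) | ‖a‖ ^ 2 ≤ 1} := by
    have : {a : EuclideanSpace ℝ (Fin N) | ‖a‖ ^ 2 ≤ 1} = Metric.closedBall 0 1 := by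
      ext a
      simp [sq_le_one_iff_abs_le_one]
    rw [this]
    exact isCompact_closedBall 0 1
  have hne : {a : EuclideanSpace ℝ (Fin N) | ‖a‖ ^ 2 ≤ 1}.Nonempty := ⟨0, by simp⟩
  have hcont : Continuous fun a : EuclideanSpace ℝ (Fin N) =>
      max (α * lam * (1 - ‖a‖ ^ 2))
        (ι₁l / n * ‖a‖ ^ 2 - 2 * r₂ * T * Real.sqrt (‖a‖ ^ 2 * (1 - ‖a‖ ^ 2))) := by fun_prop
  obtain ⟨a, ha, hmin⟩ := hK.exists_sInf_image_eq hne hcont.continuousOn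
  rw [iota2Lower, hmin]
  have ha' : ‖a‖ ^ 2 ≤ 1 := ha
  rcases ha'.lt_or_eq with h | h
  · exact lt_max_of_lt_left (mul_pos (mul_pos hα hlam) (by linarith))
  · refine lt_max_of_lt_right ?_
    rw [h]
    simp only [mul_one, sub_self, mul_zero, Real.sqrt_zero, sub_zero]
    positivity

/-! ### Matrices as continuous linear maps -/

section MatrixCLM

variable {m k : Type*} [Fintype m] [Fintype k] [DecidableEq k]

/-- The operator between Euclidean spaces given by a matrix. -/
noncomputable def matrixCLM :
    Matrix m k ℝ ≃ₗ[ℝ] (EuclideanSpace ℝ k →L[ℝ] EuclideanSpace ℝ m) :=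
  (Matrix.toEuclideanLin (𝕜 := ℝ)).trans LinearMap.toContinuousLinearMap

theorem matrixCLM_toLp (A : Matrix m k ℝ) (v : k → ℝ) :
    matrixCLM A (WithLp.toLp 2 v) = WithLp.toLp 2 (A *ᵥ v) := rfl

theorem norm_matrixCLM (A : Matrix m k ℝ) : ‖matrixCLM A‖ = ‖A‖ := rfl

theorem adjoint_matrixCLM [DecidableEq m] (A : Matrix m k ℝ) : (matrixCLM A).adjoint = matrixCLM Aᵀ := by
  rw [← Matrix.conjTranspose_eq_transpose_of_trivial]
  ext1 v
  change _ = Matrix.toEuclideanLin Aᴴ v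
  rw [Matrix.toEuclideanLin_conjTranspose_eq_adjoint]
  rfl

theorem stronglyMeasurable_matrixCLM [DecidableEq m] {A : ℝ → Matrix m k ℝ}
    (hA : ∀ i j, Measurable fun t => A t i j) :
    StronglyMeasurable fun t => matrixCLM (A t) := by
  have h : ∀ t, matrixCLM (A t) = ∑ i, ∑ j, A t i j • matrixCLM (Matrix.single i j (1 : ℝ)) := by
    intro t
    conv_lhs => rw [Matrix.matrix_eq_sum_single (A t)]
    simp only [map_sum, ← map_smul, Matrix.smul_single, smul_eq_mul, mul_one]
  simp only [h]
  refine Finset.stronglyMeasurable_fun_sum _ fun i _ =>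
    Finset.stronglyMeasurable_fun_sum _ fun j _ => ?_
  exact (hA i j).stronglyMeasurable.smul_const _

theorem inner_toLp (u v : m → ℝ) :
    inner ℝ (WithLp.toLp 2 u : EuclideanSpace ℝ m) (WithLp.toLp 2 v) = u ⬝ᵥ v := by
  rw [EuclideanSpace.inner_toLp_toLp, star_trivial, dotProduct_comm]

theorem sq_norm_toLp (u : m → ℝ) :
    ‖(WithLp.toLp 2 u : EuclideanSpace ℝ m)‖ ^ 2 = u ⬝ᵥ u := by
  rw [← real_inner_self_eq_norm_sq, inner_toLp]

theorem abs_dotProduct_mulVec_le (A : Matrix m k ℝ) (u : m → ℝ) (v : k → ℝ) :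
    |u ⬝ᵥ (A *ᵥ v)| ≤ ‖A‖ * (Real.sqrt (u ⬝ᵥ u) * Real.sqrt (v ⬝ᵥ v)) := by
  rw [← sq_norm_toLp, ← sq_norm_toLp, Real.sqrt_sq (norm_nonneg _), Real.sqrt_sq (norm_nonneg _),
    ← inner_toLp, ← matrixCLM_toLp]
  refine (abs_real_inner_le_norm _ _).trans ?_
  have := (matrixCLM A).le_opNorm (WithLp.toLp 2 v)
  rw [norm_matrixCLM] at this
  calc _ ≤ ‖(WithLp.toLp 2 u : EuclideanSpace ℝ m)‖ *
        (‖A‖ * ‖(WithLp.toLp 2 v : EuclideanSpace ℝ k)‖) := by gcongr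
    _ = _ := by ring

theorem dotProduct_mulVec_self_le (A : Matrix k k ℝ) (v : k → ℝ) :
    v ⬝ᵥ (A *ᵥ v) ≤ ‖A‖ * (v ⬝ᵥ v) := by
  have h := (le_abs_self _).trans (abs_dotProduct_mulVec_le A v v)
  rwa [Real.mul_self_sqrt (by rw [← sq_norm_toLp]; positivity)] at h

theorem abs_entry_le_norm [DecidableEq m] (A : Matrix m k ℝ) (i : m) (j : k) : |A i j| ≤ ‖A‖ := by
  have h := abs_dotProduct_mulVec_le A (Pi.single i 1) (Pi.single j 1)
  simpa using h

end MatrixCLM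

/-! ### Extension of outputs by zero -/

section Extend

variable {n N Ny : ℕ} {E : Finset (Fin n × Fin n)} {a : Type*}

/-- Index of the outputs of the complete graph. -/
abbrev FullOutIdx (n N Ny : ℕ) := (Fin n × Fin Ny) ⊕ ((Fin n × Fin n) × Fin N)

theorem extendByZero_dotProduct (f h : OutIdx n N Ny E → ℝ) :
    extendByZero f ⬝ᵥ extendByZero h = f ⬝ᵥ h := by
  simp only [dotProduct, Fintype.sum_sum_type]
  congr 1
  refine (Fintype.sum_prod_type _).trans (Eq.trans ?_ (Fintype.sum_prod_type _).symm)
  rw [← Finset.sum_subset (Finset.subset_univ E)]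
  · rw [← Finset.sum_coe_sort]
    refine Finset.sum_congr rfl fun e _ => Finset.sum_congr rfl fun k _ => ?_
    simp [extendByZero]
  · intro e _ he
    simp [extendByZero, he]

/-- Extension of the rows of a matrix by zero. -/
def extendRows (A : Matrix (OutIdx n N Ny E) a ℝ) : Matrix (FullOutIdx n N Ny) a ℝ :=
  Matrix.of fun y j => extendByZero (fun i => A i j) y

theorem extendRows_mulVec [Fintype a] (A : Matrix (OutIdx n N Ny E) a ℝ) (v : a → ℝ) :
    extendRows A *ᵥ v = extendByZero (A *ᵥ v) := by
  funext y
  rcases y with y | ⟨e, k⟩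
  · rfl
  · by_cases he : e ∈ E <;> simp [extendRows, extendByZero, Matrix.mulVec, dotProduct, he]

theorem extendRows_transpose_mulVec (A : Matrix (OutIdx n N Ny E) a ℝ)
    (u : OutIdx n N Ny E → ℝ) : (extendRows A)ᵀ *ᵥ extendByZero u = Aᵀ *ᵥ u :=
  funext fun j => extendByZero_dotProduct (fun i => A i j) u

theorem extendRows_transpose_transpose_mulVec (A : Matrix a (OutIdx n N Ny E) ℝ)
    (u : OutIdx n N Ny E → ℝ) : (extendRows Aᵀ)ᵀ *ᵥ extendByZero u = A *ᵥ u :=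
  extendRows_transpose_mulVec Aᵀ u

end Extend

/-! ### Excitation of the stacked system -/

section Excitation

variable {n N Ny : ℕ}

theorem laplacian_apply (E : Finset (Fin n × Fin n)) (i j : Fin n) :
    laplacian E i j = ∑ e : Fin n × Fin n, if e ∈ E then
      (if i = e.1 then 1 else if i = e.2 then -1 else 0) *
        (if j = e.1 then 1 else if j = e.2 then -1 else 0) else 0 := by
  rw [← Finset.sum_filter, Finset.filter_mem_eq_inter, Finset.univ_inter, ← Finset.sum_coe_sort]
  rfl

theorem laplacian_mulVec_one {G : SimpleGraph (Fin n)} {E : Finset (Fin n × Fin n)}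
    (hE : IsOrientation G E) : laplacian E *ᵥ 1 = 0 := by
  have h : (incidence E)ᵀ *ᵥ (1 : Fin n → ℝ) = 0 := by
    funext e
    have hne : e.1.2 ≠ e.1.1 := by
      intro h
      have h1 : e.1 = (e.1.1, e.1.1) := Prod.ext rfl h
      have h2 := e.2
      rw [h1] at h2
      exact hE.asymm _ _ h2 h2
    simp only [Matrix.mulVec, dotProduct, Matrix.transpose_apply, incidence, Matrix.of_apply,
      Pi.one_apply, mul_one, Pi.zero_apply]
    have h3 : ∀ i : Fin n, (if i = e.1.1 then (1 : ℝ) else if i = e.1.2 then -1 else 0) =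
        (if i = e.1.1 then 1 else 0) - (if i = e.1.2 then 1 else 0) := by
      intro i
      by_cases h4 : i = e.1.1
      · have h5 : i ≠ e.1.2 := fun h6 => hne (h6.symm.trans h4)
        simp [h4, h4 ▸ h5]
      · simp [h4]
        split_ifs <;> simp
    simp [h3, Finset.sum_sub_distrib]
  rw [laplacian, ← Matrix.mulVec_mulVec, h, Matrix.mulVec_zero]

theorem blockDiag_mulVec {p q : ℕ} (A : Fin n → Matrix (Fin p) (Fin q) ℝ)
    (x : Fin n × Fin q → ℝ) (i : Fin n) (l : Fin p) :
    (blockDiag A *ᵥ x) (i, l) = (A i *ᵥ fun k => x (i, k)) l := by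
  simp only [Matrix.mulVec, dotProduct, blockDiag, Matrix.of_apply, Fintype.sum_prod_type]
  rw [Finset.sum_eq_single i]
  · simp
  · intro j _ hj
    simp [hj.symm]
  · simp

theorem dotProduct_lambdaBar_mulVec {α : ℝ} (hα : 0 ≤ α)
    (C : Fin n → Matrix (Fin Ny) (Fin N) ℝ) (E : Finset (Fin n × Fin n))
    (x : StateIdx n N → ℝ) :
    (lambdaBar α C E *ᵥ x) ⬝ᵥ (lambdaBar α C E *ᵥ x) =
      ∑ i, (fun k => x (i, k)) ⬝ᵥ (((C i)ᵀ * C i) *ᵥ fun k => x (i, k)) +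
      α * ∑ k, (fun i => x (i, k)) ⬝ᵥ (laplacian E *ᵥ fun i => x (i, k)) := by
  have hsq : ∀ {a b : Type} [Fintype a] [Fintype b] (A : Matrix a b ℝ) (v : b → ℝ),
      v ⬝ᵥ ((Aᵀ * A) *ᵥ v) = ∑ i, (A *ᵥ v) i * (A *ᵥ v) i := by
    intro a b _ _ A v
    rw [← Matrix.mulVec_mulVec, Matrix.dotProduct_mulVec, Matrix.vecMul_transpose]
    rfl
  have hlap : ∀ v : Fin n → ℝ, v ⬝ᵥ (laplacian E *ᵥ v) =
      ∑ e, ((incidence E)ᵀ *ᵥ v) e * ((incidence E)ᵀ *ᵥ v) e := fun v => by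
    have := hsq (incidence E)ᵀ v
    rwa [Matrix.transpose_transpose] at this
  have hkr : ∀ (e : E) (k : Fin N),
      (((incidence E)ᵀ ⊗ₖ (1 : Matrix (Fin N) (Fin N) ℝ)) *ᵥ x) (e, k) =
        ((incidence E)ᵀ *ᵥ fun i => x (i, k)) e := by
    intro e k
    simp only [Matrix.mulVec, dotProduct, Matrix.kroneckerMap_apply, Fintype.sum_prod_type]
    refine Finset.sum_congr rfl fun i _ => ?_
    rw [Finset.sum_eq_single k]
    · simp
    · intro l _ hl
      simp [hl.symm]
    · simp
  rw [lambdaBar, Matrix.fromRows_mulVec, dotProduct, Fintype.sum_sum_type]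
  congr 1
  · simp only [Sum.elim_inl, Fintype.sum_prod_type, blockDiag_mulVec, hsq]
  · simp only [Sum.elim_inr, Fintype.sum_prod_type, Matrix.smul_mulVec, Pi.smul_apply, hkr,
      smul_eq_mul, hlap]
    rw [Finset.sum_comm, Finset.mul_sum]
    refine Finset.sum_congr rfl fun k _ => ?_
    rw [Finset.mul_sum]
    refine Finset.sum_congr rfl fun e _ => ?_
    rw [mul_mul_mul_comm, Real.mul_self_sqrt hα]

theorem measurable_extendRows_lambdaBar {α : ℝ} {C : ℝ → Fin n → Matrix (Fin Ny) (Fin N) ℝ}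
    {E : ℝ → Finset (Fin n × Fin n)} (hC : ∀ i k l, Measurable fun t => C t i k l)
    (hE : ∀ e, MeasurableSet {t | e ∈ E t}) (y : FullOutIdx n N Ny) (j : StateIdx n N) :
    Measurable fun t => extendRows (lambdaBar α (C t) (E t)) y j := by
  rcases y with ⟨i, l⟩ | ⟨e, k⟩
  · by_cases hij : i = j.1
    · simpa [extendRows, extendByZero, lambdaBar, blockDiag, hij] using hC j.1 l j.2
    · simp [extendRows, extendByZero, lambdaBar, blockDiag, hij]
  · have h : (fun t => extendRows (lambdaBar α (C t) (E t)) (Sum.inr (e, k)) j) = fun t =>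
        if e ∈ E t then Real.sqrt α * ((if j.1 = e.1 then 1 else if j.1 = e.2 then -1 else 0) *
          (1 : Matrix (Fin N) (Fin N) ℝ) k j.2) else 0 := by
      funext t
      by_cases he : e ∈ E t <;> simp [extendRows, extendByZero, lambdaBar, incidence, he]
    rw [h]
    exact Measurable.ite (hE e) measurable_const measurable_const

theorem integral_dotProduct_mulVec {a b : Type*} [Fintype a] [Fintype b]
    {M : ℝ → Matrix a b ℝ} {t₁ t₂ : ℝ}
    (hM : ∀ i j, IntervalIntegrable (fun s => M s i j) volume t₁ t₂) (u : a → ℝ) (v : b → ℝ) :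
    IntervalIntegrable (fun s => u ⬝ᵥ (M s *ᵥ v)) volume t₁ t₂ ∧
      ∫ s in t₁..t₂, u ⬝ᵥ (M s *ᵥ v) =
        u ⬝ᵥ ((Matrix.of fun i j => ∫ s in t₁..t₂, M s i j) *ᵥ v) := by
  simp only [Matrix.mulVec, dotProduct, Matrix.of_apply]
  have h1 : ∀ i j, IntervalIntegrable (fun s => M s i j * v j) volume t₁ t₂ :=
    fun i j => (hM i j).mul_const _
  have h2 : ∀ i, IntervalIntegrable (fun s => ∑ j, M s i j * v j) volume t₁ t₂ := fun i => by
    convert! IntervalIntegrable.sum Finset.univ fun j _ => h1 i j using 1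
    ext s; simp
  constructor
  · convert! IntervalIntegrable.sum Finset.univ fun i _ => (h2 i).const_mul (u i) using 1
    ext s; simp
  · rw [intervalIntegral.integral_finsetSum fun i _ => (h2 i).const_mul (u i)]
    refine Finset.sum_congr rfl fun i _ => ?_
    rw [intervalIntegral.integral_const_mul,
      intervalIntegral.integral_finsetSum fun j _ => h1 i j]
    simp only [intervalIntegral.integral_mul_const]

/-- A real symmetric matrix that annihilates the constants and whose other eigenvalues are at
least `lam` dominates `lam` times the projection onto the vectors of mean zero. -/
theorem mul_variance_le_dotProduct_mulVec {A : Matrix (Fin n) (Fin n) ℝ} (hA : A.IsHermitian)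
    (h1 : A *ᵥ 1 = 0) {lam : ℝ} (hlam : 0 < lam) {i₀ : Fin n} (h0 : hA.eigenvalues i₀ = 0)
    (hi : ∀ i, i ≠ i₀ → lam ≤ hA.eigenvalues i) (v : Fin n → ℝ) :
    lam * (v ⬝ᵥ v - (∑ i, v i) ^ 2 / n) ≤ v ⬝ᵥ (A *ᵥ v) := by
  have hn : 0 < n := i₀.pos
  set e := hA.eigenvectorBasis with he
  have heig : ∀ i (w : Fin n → ℝ), inner ℝ (e i) (WithLp.toLp 2 (A *ᵥ w)) =
      hA.eigenvalues i * inner ℝ (e i) (WithLp.toLp 2 w) := by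
    intro i w
    have h2 := hA.mulVec_eigenvectorBasis i
    have h3 : ∀ z : Fin n → ℝ, inner ℝ (e i) (WithLp.toLp 2 z) = (e i).ofLp ⬝ᵥ z :=
      fun z => inner_toLp (e i).ofLp z
    have hT : Aᵀ = A := by
      rw [← Matrix.conjTranspose_eq_transpose_of_trivial]; exact hA
    rw [h3, h3, Matrix.dotProduct_mulVec, ← Matrix.mulVec_transpose, hT, h2, smul_dotProduct,
      smul_eq_mul]
  have hpars : ∀ u w : Fin n → ℝ, u ⬝ᵥ w =
      ∑ i, inner ℝ (e i) (WithLp.toLp 2 u) * inner ℝ (e i) (WithLp.toLp 2 w) := by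
    intro u w
    rw [← inner_toLp, ← e.sum_inner_mul_inner]
    exact Finset.sum_congr rfl fun i _ => by rw [real_inner_comm]
  have hone : ∀ i, i ≠ i₀ → inner ℝ (e i) (WithLp.toLp 2 (1 : Fin n → ℝ)) = 0 := by
    intro i hne
    have h2 := heig i 1
    rw [h1, WithLp.toLp_zero, inner_zero_right] at h2
    exact (mul_eq_zero.1 h2.symm).resolve_left (hlam.trans_le (hi i hne)).ne'
  have hsingle : ∀ w : Fin n → ℝ, (1 : Fin n → ℝ) ⬝ᵥ w =
      inner ℝ (e i₀) (WithLp.toLp 2 (1 : Fin n → ℝ)) * inner ℝ (e i₀) (WithLp.toLp 2 w) := by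
    intro w
    rw [hpars, Finset.sum_eq_single i₀]
    · intro i _ hne
      rw [hone i hne, zero_mul]
    · simp
  have hnn : (n : ℝ) = inner ℝ (e i₀) (WithLp.toLp 2 (1 : Fin n → ℝ)) ^ 2 := by
    have h2 := hsingle 1
    rw [← sq] at h2
    rw [← h2]
    simp
  have hmean : (∑ i, v i) ^ 2 / n = inner ℝ (e i₀) (WithLp.toLp 2 v) ^ 2 := by
    have h2 := hsingle v
    rw [one_dotProduct] at h2
    have hn' : (n : ℝ) ≠ 0 := by positivity
    rw [h2, mul_pow, ← hnn]
    field_simp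
  rw [hmean, hpars v v, hpars v (A *ᵥ v)]
  simp only [heig]
  rw [← Finset.add_sum_erase _ _ (Finset.mem_univ i₀),
    ← Finset.add_sum_erase _ _ (Finset.mem_univ i₀), h0, sq, add_sub_cancel_left, Finset.mul_sum,
    zero_mul, mul_zero, zero_add]
  refine Finset.sum_le_sum fun i hmem => ?_
  have h2 := hi i (Finset.ne_of_mem_erase hmem)
  nlinarith [mul_self_nonneg (inner ℝ (e i) (WithLp.toLp 2 v) : ℝ)]

end Excitation

section StackedExcitation

variable {n N Ny : ℕ}

theorem intervalIntegrable_of_measurable_of_bounded {f : ℝ → ℝ} (hf : Measurable f) {B : ℝ}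
    (hB : ∀ s, 0 ≤ s → |f s| ≤ B) {a b : ℝ} (ha : 0 ≤ a) (hb : 0 ≤ b) :
    IntervalIntegrable f volume a b := by
  rw [intervalIntegrable_iff, uIoc]
  refine Measure.integrableOn_of_bounded (M := B) measure_Ioc_lt_top.ne
    hf.aestronglyMeasurable ?_
  refine (ae_restrict_iff' measurableSet_Ioc).2 (Filter.Eventually.of_forall fun s hs => ?_)
  exact hB s ((le_min ha hb).trans hs.1.le)

theorem dotProduct_transpose_mul_self_mulVec_nonneg {a b : Type*} [Fintype a] [Fintype b]
    (A : Matrix a b ℝ) (v : b → ℝ) : 0 ≤ v ⬝ᵥ ((Aᵀ * A) *ᵥ v) := by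
  rw [← Matrix.mulVec_mulVec, Matrix.dotProduct_mulVec, Matrix.vecMul_transpose]
  exact Finset.sum_nonneg fun i _ => mul_self_nonneg _

/-- Replacing the local states by a common vector `b` changes the regressor energy by at most a
multiple of the distance. -/
theorem sum_regressor_ge {C : Fin n → Matrix (Fin Ny) (Fin N) ℝ} {r₂ : ℝ} (hr : 0 ≤ r₂)
    (hC : ∀ i, ‖(C i)ᵀ * C i‖ ≤ r₂) (x : StateIdx n N → ℝ) (b : Fin N → ℝ) :
    b ⬝ᵥ ((∑ i, (C i)ᵀ * C i) *ᵥ b) - 2 * r₂ * (Real.sqrt (b ⬝ᵥ b) *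
        Real.sqrt (n * ∑ i, ∑ k, (x (i, k) - b k) ^ 2)) ≤
      ∑ i, (fun k => x (i, k)) ⬝ᵥ (((C i)ᵀ * C i) *ᵥ fun k => x (i, k)) := by
  set w : Fin n → Fin N → ℝ := fun i k => x (i, k) - b k with hw
  have hww : ∀ i, w i ⬝ᵥ w i = ∑ k, (x (i, k) - b k) ^ 2 := fun i =>
    Finset.sum_congr rfl fun k _ => (sq _).symm
  have hterm : ∀ i, b ⬝ᵥ (((C i)ᵀ * C i) *ᵥ b) -
      2 * r₂ * (Real.sqrt (b ⬝ᵥ b) * Real.sqrt (w i ⬝ᵥ w i)) ≤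
      (fun k => x (i, k)) ⬝ᵥ (((C i)ᵀ * C i) *ᵥ fun k => x (i, k)) := by
    intro i
    set A := (C i)ᵀ * C i with hA
    have hx : (fun k => x (i, k)) = b + w i := by funext k; simp [hw]
    have hsymm : w i ⬝ᵥ (A *ᵥ b) = b ⬝ᵥ (A *ᵥ w i) := by
      have hT : Aᵀ = A := by rw [hA, Matrix.transpose_mul, Matrix.transpose_transpose]
      rw [Matrix.dotProduct_mulVec, ← Matrix.mulVec_transpose, hT, dotProduct_comm]
    have h1 := abs_dotProduct_mulVec_le A b (w i)
    have h2 := neg_abs_le (b ⬝ᵥ (A *ᵥ w i))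
    have h3 : ‖A‖ * (Real.sqrt (b ⬝ᵥ b) * Real.sqrt (w i ⬝ᵥ w i)) ≤
        r₂ * (Real.sqrt (b ⬝ᵥ b) * Real.sqrt (w i ⬝ᵥ w i)) := by
      gcongr
      exact hC i
    have h4 := dotProduct_transpose_mul_self_mulVec_nonneg (C i) (w i)
    rw [hx, Matrix.mulVec_add, add_dotProduct, dotProduct_add, dotProduct_add, hsymm]
    linarith
  have hcs : ∑ i, Real.sqrt (w i ⬝ᵥ w i) ≤
      Real.sqrt (n * ∑ i, ∑ k, (x (i, k) - b k) ^ 2) := by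
    refine Real.le_sqrt_of_sq_le ?_
    have h := sq_sum_le_card_mul_sum_sq (s := Finset.univ)
      (f := fun i => Real.sqrt (w i ⬝ᵥ w i))
    simp only [Finset.card_univ, Fintype.card_fin] at h
    refine h.trans (le_of_eq ?_)
    congr 1
    refine Finset.sum_congr rfl fun i _ => ?_
    rw [hww, Real.sq_sqrt (Finset.sum_nonneg fun k _ => sq_nonneg _)]
  have hsum := Finset.sum_le_sum fun i (_ : i ∈ Finset.univ) => hterm i
  rw [Finset.sum_sub_distrib, ← Finset.mul_sum, ← Finset.mul_sum] at hsum
  rw [Matrix.sum_mulVec, dotProduct_sum]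
  have h5 := mul_le_mul_of_nonneg_left
    (mul_le_mul_of_nonneg_left hcs (Real.sqrt_nonneg (b ⬝ᵥ b))) (by positivity : 0 ≤ 2 * r₂)
  linarith

theorem sum_variance_eq (hn : 0 < n) (x : StateIdx n N → ℝ) :
    (∑ k, ((fun i => x (i, k)) ⬝ᵥ (fun i => x (i, k)) - (∑ i, x (i, k)) ^ 2 / n) =
      x ⬝ᵥ x - n * ((fun k => (∑ i, x (i, k)) / n) ⬝ᵥ fun k => (∑ i, x (i, k)) / n)) ∧
    ∑ i, ∑ k, (x (i, k) - (∑ j, x (j, k)) / n) ^ 2 =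
      x ⬝ᵥ x - n * ((fun k => (∑ i, x (i, k)) / n) ⬝ᵥ fun k => (∑ i, x (i, k)) / n) := by
  have hn' : (n : ℝ) ≠ 0 := by positivity
  have hx : x ⬝ᵥ x = ∑ k, ∑ i, x (i, k) * x (i, k) := by
    rw [dotProduct, Fintype.sum_prod_type, Finset.sum_comm]
  rw [hx]
  simp only [dotProduct]
  constructor
  · rw [Finset.sum_sub_distrib, Finset.mul_sum]
    congr 1
    refine Finset.sum_congr rfl fun k _ => ?_
    field_simp
  · rw [Finset.sum_comm, Finset.mul_sum, ← Finset.sum_sub_distrib]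
    refine Finset.sum_congr rfl fun k _ => ?_
    set m := (∑ j, x (j, k)) / n with hm
    have hsum : ∑ j, x (j, k) = n * m := by rw [hm]; field_simp
    have h1 : ∀ i, (x (i, k) - m) ^ 2 = x (i, k) * x (i, k) - 2 * m * x (i, k) + m ^ 2 :=
      fun i => by ring
    simp only [h1, Finset.sum_add_distrib, Finset.sum_sub_distrib, ← Finset.mul_sum, hsum,
      Finset.sum_const, Finset.card_univ, Fintype.card_fin, nsmul_eq_mul]
    ring

variable {C : ℝ → Fin n → Matrix (Fin Ny) (Fin N) ℝ} {E : ℝ → Finset (Fin n × Fin n)}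
  {G : ℝ → SimpleGraph (Fin n)} {T ι₁u ι₁l r₂ r₃ lam α : ℝ}

theorem ExcitationAssumption.measurable_laplacian
    (hA : ExcitationAssumption C E T ι₁u ι₁l r₂ r₃ lam) (i j : Fin n) :
    Measurable fun s => laplacian (E s) i j := by
  simp only [laplacian_apply]
  exact Finset.measurable_fun_sum _ fun e _ =>
    Measurable.ite (hA.measurable_E e) measurable_const measurable_const

theorem ExcitationAssumption.measurable_regressor
    (hA : ExcitationAssumption C E T ι₁u ι₁l r₂ r₃ lam) (i : Fin n) (k l : Fin N) :
    Measurable fun s => ((C s i)ᵀ * C s i) k l := by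
  simp only [Matrix.mul_apply, Matrix.transpose_apply]
  exact Finset.measurable_fun_sum _ fun e _ =>
    (hA.measurable_C i e k).mul (hA.measurable_C i e l)

/-- Average excitation of the stacked output map. -/
theorem ExcitationAssumption.iota2Lower_mul_le (hE : ∀ t, IsOrientation (G t) (E t))
    (hA : ExcitationAssumption C E T ι₁u ι₁l r₂ r₃ lam) (hα : 0 < α) {t : ℝ} (ht : T ≤ t)
    (x : StateIdx n N → ℝ) :
    iota2Lower n N α T ι₁l r₂ lam * (x ⬝ᵥ x) ≤
      ∫ s in (t - T)..t,
        (lambdaBar α (C s) (E s) *ᵥ x) ⬝ᵥ (lambdaBar α (C s) (E s) *ᵥ x) := by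
  obtain ⟨i₀, h0, hi⟩ := hA.connected_on_average t ht
  have hn : 0 < n := i₀.pos
  have hn' : (0 : ℝ) < n := by positivity
  have hT := hA.T_pos
  have hr₂ := hA.r₂_pos
  have ht0 : 0 ≤ t := hT.le.trans ht
  have htT : 0 ≤ t - T := sub_nonneg.2 ht
  have htt : t - T ≤ t := by linarith
  have hLi : ∀ i j, IntervalIntegrable (fun s => laplacian (E s) i j) volume (t - T) t :=
    fun i j => intervalIntegrable_of_measurable_of_bounded (hA.measurable_laplacian i j)
      (fun s hs => (abs_entry_le_norm _ i j).trans (hA.laplacian_bound s hs)) htT ht0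
  have hCi : ∀ i k l, IntervalIntegrable (fun s => ((C s i)ᵀ * C s i) k l) volume (t - T) t :=
    fun i k l => intervalIntegrable_of_measurable_of_bounded (hA.measurable_regressor i k l)
      (fun s hs => (abs_entry_le_norm _ k l).trans (hA.regressor_bound s hs i)) htT ht0
  have hSi : ∀ k l, IntervalIntegrable (fun s => (∑ i, (C s i)ᵀ * C s i) k l)
      volume (t - T) t := fun k l => by
    convert! IntervalIntegrable.sum Finset.univ fun i _ => hCi i k l using 1
    ext s; simp [Matrix.sum_apply]
  set b : Fin N → ℝ := fun k => (∑ i, x (i, k)) / n with hb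
  obtain ⟨hvar1, hvar2⟩ := sum_variance_eq hn x
  rw [← hb] at hvar1 hvar2
  set W := x ⬝ᵥ x - n * (b ⬝ᵥ b) with hW
  have hW0 : 0 ≤ W := by
    rw [← hvar2]
    exact Finset.sum_nonneg fun i _ => Finset.sum_nonneg fun k _ => sq_nonneg _
  have hbb : 0 ≤ b ⬝ᵥ b := by rw [← sq_norm_toLp]; positivity
  set qC : ℝ → ℝ := fun s =>
    ∑ i, (fun k => x (i, k)) ⬝ᵥ (((C s i)ᵀ * C s i) *ᵥ fun k => x (i, k)) with hqC
  set qL : ℝ → ℝ := fun s =>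
    ∑ k, (fun i => x (i, k)) ⬝ᵥ (laplacian (E s) *ᵥ fun i => x (i, k)) with hqL
  have hqCi : IntervalIntegrable qC volume (t - T) t := by
    convert! IntervalIntegrable.sum Finset.univ fun i _ =>
      (integral_dotProduct_mulVec (hCi i) (fun k => x (i, k)) fun k => x (i, k)).1 using 1
    ext s; simp [hqC]
  have hqLi : IntervalIntegrable qL volume (t - T) t := by
    convert! IntervalIntegrable.sum Finset.univ fun k _ =>
      (integral_dotProduct_mulVec hLi (fun i => x (i, k)) fun i => x (i, k)).1 using 1
    ext s; simp [hqL]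
  have hqC0 : 0 ≤ ∫ s in (t - T)..t, qC s := intervalIntegral.integral_nonneg htt fun s _ =>
    Finset.sum_nonneg fun i _ => dotProduct_transpose_mul_self_mulVec_nonneg _ _
  have hgraph : lam * W ≤ ∫ s in (t - T)..t, qL s := by
    rw [hqL, intervalIntegral.integral_finsetSum fun k _ =>
      (integral_dotProduct_mulVec hLi (fun i => x (i, k)) fun i => x (i, k)).1, ← hvar1,
      Finset.mul_sum]
    refine Finset.sum_le_sum fun k _ => ?_
    rw [(integral_dotProduct_mulVec hLi (fun i => x (i, k)) fun i => x (i, k)).2]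
    refine mul_variance_le_dotProduct_mulVec (laplacianIntegral_isHermitian E T t) ?_ hA.lam_pos
      h0 hi _
    funext i
    have h1 := (integral_dotProduct_mulVec hLi (Pi.single i 1) 1).2
    simp only [laplacian_mulVec_one (hE _), dotProduct_zero, intervalIntegral.integral_zero,
      single_dotProduct, one_mul] at h1
    exact h1.symm
  have hqL0 : 0 ≤ ∫ s in (t - T)..t, qL s :=
    (mul_nonneg hA.lam_pos.le hW0).trans hgraph
  have hreg : ι₁l * (b ⬝ᵥ b) - T * (2 * r₂ * (Real.sqrt (b ⬝ᵥ b) * Real.sqrt (n * W))) ≤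
      ∫ s in (t - T)..t, qC s := by
    have h1 : ∫ s in (t - T)..t, (b ⬝ᵥ ((∑ i, (C s i)ᵀ * C s i) *ᵥ b) -
        2 * r₂ * (Real.sqrt (b ⬝ᵥ b) * Real.sqrt (n * W))) ≤ ∫ s in (t - T)..t, qC s := by
      refine intervalIntegral.integral_mono_on htt
        ((integral_dotProduct_mulVec hSi b b).1.sub (by simp)) hqCi fun s hs => ?_
      have h2 := sum_regressor_ge hr₂.le (hA.regressor_bound s (htT.trans hs.1)) x b
      rwa [hvar2] at h2
    rw [intervalIntegral.integral_sub (integral_dotProduct_mulVec hSi b b).1 (by simp),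
      (integral_dotProduct_mulVec hSi b b).2, intervalIntegral.integral_const, sub_sub_cancel,
      smul_eq_mul] at h1
    have h3 := (hA.cpe_lower t ht).dotProduct_mulVec_nonneg b
    rw [star_trivial, Matrix.sub_mulVec, dotProduct_sub, Matrix.smul_mulVec, Matrix.one_mulVec,
      dotProduct_smul, smul_eq_mul] at h3
    have h4 : regressorIntegral C T t =
      Matrix.of fun k l => ∫ s in (t - T)..t, (∑ i, (C s i)ᵀ * C s i) k l := rfl
    rw [h4] at h3
    linarith
  simp only [dotProduct_lambdaBar_mulVec hα.le]
  rw [intervalIntegral.integral_add hqCi (hqLi.const_mul α), intervalIntegral.integral_const_mul]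
  have hP0 : 0 ≤ x ⬝ᵥ x := by rw [← sq_norm_toLp]; positivity
  rcases hP0.eq_or_lt with hP | hP
  · rw [← hP, mul_zero]
    exact add_nonneg hqC0 (mul_nonneg hα.le hqL0)
  set P := x ⬝ᵥ x with hPdef
  set a : EuclideanSpace ℝ (Fin N) := WithLp.toLp 2 (Real.sqrt (n / P) • b) with ha
  have hna : ‖a‖ ^ 2 = n / P * (b ⬝ᵥ b) := by
    rw [ha, sq_norm_toLp, smul_dotProduct, dotProduct_smul, smul_eq_mul, smul_eq_mul, ← mul_assoc,
      Real.mul_self_sqrt (by positivity)]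
  have h1a : 1 - ‖a‖ ^ 2 = W / P := by
    rw [hna, hW]; field_simp
  have ha1 : ‖a‖ ^ 2 ≤ 1 := by
    have : 0 ≤ W / P := by positivity
    linarith
  have hmax := iota2Lower_le_max (n := n) (T := T) (ι₁l := ι₁l) (r₂ := r₂)
    (mul_nonneg hα.le hA.lam_pos.le) ha1
  rw [h1a, hna] at hmax
  have hmul := mul_le_mul_of_nonneg_right hmax hP.le
  refine hmul.trans ?_
  rw [max_mul_of_nonneg _ _ hP.le]
  refine max_le ?_ ?_
  · have h1 : α * lam * (W / P) * P = α * (lam * W) := by field_simp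
    rw [h1]
    have h2 := mul_le_mul_of_nonneg_left hgraph hα.le
    linarith
  · have h1 : Real.sqrt (n / P * (b ⬝ᵥ b) * (W / P)) =
        Real.sqrt (b ⬝ᵥ b) * Real.sqrt (n * W) / P := by
      rw [← Real.sqrt_mul hbb, ← Real.sqrt_sq hP.le, ← Real.sqrt_div' _ (sq_nonneg P),
        Real.sqrt_sq hP.le]
      congr 1
      field_simp
    rw [h1]
    have h2 : (ι₁l / n * (n / P * (b ⬝ᵥ b)) -
        2 * r₂ * T * (Real.sqrt (b ⬝ᵥ b) * Real.sqrt (n * W) / P)) * P =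
        ι₁l * (b ⬝ᵥ b) - T * (2 * r₂ * (Real.sqrt (b ⬝ᵥ b) * Real.sqrt (n * W))) := by
      field_simp
    rw [h2]
    have h3 := mul_nonneg hα.le hqL0
    linarith

theorem ExcitationAssumption.dotProduct_lambdaBar_le
    (hA : ExcitationAssumption C E T ι₁u ι₁l r₂ r₃ lam) (hα : 0 < α) {t : ℝ} (ht : 0 ≤ t)
    (x : StateIdx n N → ℝ) :
    (lambdaBar α (C t) (E t) *ᵥ x) ⬝ᵥ (lambdaBar α (C t) (E t) *ᵥ x) ≤
      (r₂ + α * r₃) * (x ⬝ᵥ x) := by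
  have hself : ∀ {a : Type} [Fintype a] (v : a → ℝ), 0 ≤ v ⬝ᵥ v := fun v =>
    Finset.sum_nonneg fun i _ => mul_self_nonneg _
  have h1 : ∑ i, (fun k => x (i, k)) ⬝ᵥ (((C t i)ᵀ * C t i) *ᵥ fun k => x (i, k)) ≤
      r₂ * (x ⬝ᵥ x) := by
    have : x ⬝ᵥ x = ∑ i, (fun k => x (i, k)) ⬝ᵥ fun k => x (i, k) := Fintype.sum_prod_type _
    rw [this, Finset.mul_sum]
    exact Finset.sum_le_sum fun i _ => (dotProduct_mulVec_self_le _ _).trans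
      (mul_le_mul_of_nonneg_right (hA.regressor_bound t ht i) (hself _))
  have h2 : ∑ k, (fun i => x (i, k)) ⬝ᵥ (laplacian (E t) *ᵥ fun i => x (i, k)) ≤
      r₃ * (x ⬝ᵥ x) := by
    have : x ⬝ᵥ x = ∑ k, (fun i => x (i, k)) ⬝ᵥ fun i => x (i, k) :=
      (Fintype.sum_prod_type _).trans Finset.sum_comm
    rw [this, Finset.mul_sum]
    exact Finset.sum_le_sum fun i _ => (dotProduct_mulVec_self_le _ _).trans
      (mul_le_mul_of_nonneg_right (hA.laplacian_bound t ht) (hself _))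
  rw [dotProduct_lambdaBar_mulVec hα.le]
  have h3 := mul_le_mul_of_nonneg_left h2 hα.le
  linarith

/-- The stacked output map as an operator with time-independent codomain. -/
noncomputable def outputCLM (α : ℝ) (C : ℝ → Fin n → Matrix (Fin Ny) (Fin N) ℝ)
    (E : ℝ → Finset (Fin n × Fin n)) (t : ℝ) :
    EuclideanSpace ℝ (StateIdx n N) →L[ℝ] EuclideanSpace ℝ (FullOutIdx n N Ny) :=
  matrixCLM (extendRows (lambdaBar α (C t) (E t)))

theorem sq_norm_outputCLM (α : ℝ) (t : ℝ) (v : EuclideanSpace ℝ (StateIdx n N)) :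
    ‖outputCLM α C E t v‖ ^ 2 =
      (lambdaBar α (C t) (E t) *ᵥ v.ofLp) ⬝ᵥ (lambdaBar α (C t) (E t) *ᵥ v.ofLp) := by
  have h : outputCLM α C E t v =
      WithLp.toLp 2 (extendRows (lambdaBar α (C t) (E t)) *ᵥ v.ofLp) := rfl
  rw [h, sq_norm_toLp, extendRows_mulVec, extendByZero_dotProduct]

theorem ExcitationAssumption.isPersistentlyExciting (hE : ∀ t, IsOrientation (G t) (E t))
    (hA : ExcitationAssumption C E T ι₁u ι₁l r₂ r₃ lam) (hα : 0 < α) :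
    IsPersistentlyExciting (outputCLM α C E) T (r₂ + α * r₃)
      (iota2Lower n N α T ι₁l r₂ lam) := by
  have hr : 0 ≤ r₂ + α * r₃ :=
    add_nonneg hA.r₂_pos.le (mul_nonneg hα.le hA.r₃_pos.le)
  refine ⟨stronglyMeasurable_matrixCLM
    (measurable_extendRows_lambdaBar hA.measurable_C hA.measurable_E), hA.T_pos, hr,
    fun t ht => ?_, fun t ht v => ?_⟩
  · rw [← Real.sqrt_le_sqrt_iff hr, Real.sqrt_sq (norm_nonneg _)]
    refine ContinuousLinearMap.opNorm_le_bound _ (Real.sqrt_nonneg _) fun v => ?_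
    refine abs_le_of_sq_le_sq' ?_ (by positivity) |>.2
    rw [sq_norm_outputCLM, mul_pow, Real.sq_sqrt hr]
    have h := hA.dotProduct_lambdaBar_le hα ht v.ofLp
    rwa [← sq_norm_toLp v.ofLp] at h
  · simp only [sq_norm_outputCLM]
    have h := hA.iota2Lower_mul_le hE hα ht v.ofLp
    rwa [← sq_norm_toLp v.ofLp] at h

end StackedExcitation

/-! ### Consequences of the linear matrix inequality -/

section LMIConsequences

variable {n N Ny r p : ℕ} {E : Finset (Fin n × Fin n)} {Δ₁ : Matrix (Fin N) (Fin r) ℝ}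
  {Δ₂ : Matrix (OutIdx n N Ny E) (Fin r) ℝ} {Q : Matrix (Fin p) (OutIdx n N Ny E) ℝ}
  {W : Matrix (Fin p) (Fin r) ℝ} {T c₁ c₂ γ₁ γ₂ γ r₄ ι₃u ι₃l : ℝ}

theorem LMIOE.quadratic_form_nonneg (h : LMIOE Δ₁ Δ₂ Q W T c₁ c₂ γ₁ γ₂ γ r₄ ι₃u ι₃l)
    (y : OutIdx n N Ny E → ℝ) (z : Fin p → ℝ) (δ : Fin r → ℝ) (w : StateIdx n N → ℝ) :
    0 ≤ (c₁ - c₂ * T) * (y ⬝ᵥ y) - 2 * (z ⬝ᵥ (Q *ᵥ y)) + z ⬝ᵥ z - 2 * (z ⬝ᵥ (W *ᵥ δ)) -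
      δ ⬝ᵥ (phi44 Δ₁ Δ₂ c₁ c₂ γ₁ γ r₄ ι₃u ι₃l *ᵥ δ) +
      2 * (2 * c₁ / Real.sqrt (c₂ * ι₃l)) * (w ⬝ᵥ (deltaBar1 n Δ₁ *ᵥ δ)) + γ₂ * (w ⬝ᵥ w) := by
  have h1 := Matrix.PosSemidef.dotProduct_mulVec_nonneg h
    (Sum.elim (Sum.elim (Sum.elim y 0) (Sum.elim z δ)) w)
  have hT : ∀ {a b : Type} [Fintype a] [Fintype b] (A : Matrix a b ℝ) (u : b → ℝ) (v : a → ℝ),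
      u ⬝ᵥ (Aᵀ *ᵥ v) = v ⬝ᵥ (A *ᵥ u) := by
    intro a b _ _ A u v
    rw [Matrix.mulVec_transpose, dotProduct_comm, Matrix.dotProduct_mulVec]
  rw [star_trivial, Matrix.neg_mulVec, dotProduct_neg, Matrix.fromBlocks_mulVec, Phi11OE, Phi12,
    Matrix.transpose_fromRows, Matrix.transpose_fromRows, Matrix.transpose_fromRows] at h1
  simp only [Sum.elim_comp_inl, Sum.elim_comp_inr, Matrix.fromBlocks_mulVec,
    Matrix.fromRows_mulVec, Matrix.fromCols_mulVec, sumElim_dotProduct_sumElim, dotProduct_add,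
    Matrix.zero_mulVec, Matrix.transpose_zero, Matrix.mulVec_zero, dotProduct_zero,
    Matrix.smul_mulVec, Matrix.neg_mulVec, Matrix.one_mulVec, dotProduct_smul, dotProduct_neg,
    Matrix.transpose_smul, Matrix.transpose_transpose, smul_eq_mul, Sum.elim_zero_zero, hT,
    zero_add, add_zero] at h1
  linarith

theorem LMIOE.sq_norm_output_le (h : LMIOE Δ₁ Δ₂ Q W T c₁ c₂ γ₁ γ₂ γ r₄ ι₃u ι₃l)
    (y : OutIdx n N Ny E → ℝ) : (Q *ᵥ y) ⬝ᵥ (Q *ᵥ y) ≤ (c₁ - c₂ * T) * (y ⬝ᵥ y) := by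
  have h1 := h.quadratic_form_nonneg y (Q *ᵥ y) 0 0
  simp only [Matrix.mulVec_zero, dotProduct_zero, mul_zero] at h1
  linarith

theorem LMIOE.gamma2_nonneg (h : LMIOE Δ₁ Δ₂ Q W T c₁ c₂ γ₁ γ₂ γ r₄ ι₃u ι₃l) (hn : 0 < n)
    (hN : 0 < N) : 0 ≤ γ₂ := by
  have h1 := h.quadratic_form_nonneg 0 0 0 (Pi.single (⟨0, hn⟩, ⟨0, hN⟩) 1)
  simpa using h1

theorem dotProduct_phi44_mulVec (δ : Fin r → ℝ) :
    δ ⬝ᵥ (phi44 Δ₁ Δ₂ c₁ c₂ γ₁ γ r₄ ι₃u ι₃l *ᵥ δ) =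
      8 * c₂ * ι₃u ^ 2 / ι₃l * ((deltaBar1 n Δ₁ *ᵥ δ) ⬝ᵥ (deltaBar1 n Δ₁ *ᵥ δ)) +
      (c₁ + 8 * c₂ * ι₃u ^ 2 * r₄ * γ₁ / ι₃l) * ((Δ₂ *ᵥ δ) ⬝ᵥ (Δ₂ *ᵥ δ)) - γ * (δ ⬝ᵥ δ) := by
  have hsq : ∀ {a b : Type} [Fintype a] [Fintype b] (A : Matrix a b ℝ) (v : b → ℝ),
      v ⬝ᵥ ((Aᵀ * A) *ᵥ v) = (A *ᵥ v) ⬝ᵥ (A *ᵥ v) := by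
    intro a b _ _ A v
    rw [← Matrix.mulVec_mulVec, Matrix.dotProduct_mulVec, Matrix.vecMul_transpose]
  rw [phi44, Matrix.sub_mulVec, Matrix.add_mulVec, Matrix.smul_mulVec, Matrix.smul_mulVec,
    Matrix.smul_mulVec, Matrix.one_mulVec, dotProduct_sub, dotProduct_add, dotProduct_smul,
    dotProduct_smul, dotProduct_smul, hsq, hsq]
  rfl

theorem dotProduct_self_nonneg' {a : Type*} [Fintype a] (v : a → ℝ) : 0 ≤ v ⬝ᵥ v :=
  Finset.sum_nonneg fun _ _ => mul_self_nonneg _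

/-- Weighted bound on the disturbance channels. -/
theorem LMIOE.disturbance_le (h : LMIOE Δ₁ Δ₂ Q W T c₁ c₂ γ₁ γ₂ γ r₄ ι₃u ι₃l)
    (hWW : Wᵀ * W = 1) (hc₁ : 0 < c₁) (hc₂ : 0 < c₂) (hι : 0 < ι₃l) (hr₄ : 0 ≤ r₄)
    (hγ₁ : 0 ≤ γ₁) (hγ₂ : 0 ≤ γ₂) {g : ℝ} (hg : γ₂ = 0 ∨ g ^ 2 = γ₂) (δ : Fin r → ℝ) :
    c₁ * ((Δ₂ *ᵥ δ) ⬝ᵥ (Δ₂ *ᵥ δ)) + 4 * c₁ ^ 2 / (c₂ * ι₃l * g ^ 2) *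
      ((deltaBar1 n Δ₁ *ᵥ δ) ⬝ᵥ (deltaBar1 n Δ₁ *ᵥ δ)) ≤ (γ - 1) * (δ ⬝ᵥ δ) := by
  have hWδ : (W *ᵥ δ) ⬝ᵥ (W *ᵥ δ) = δ ⬝ᵥ δ := by
    rw [Matrix.dotProduct_mulVec, Matrix.vecMul_mulVec, hWW, Matrix.vecMul_one]
  set D := (deltaBar1 n Δ₁ *ᵥ δ) ⬝ᵥ (deltaBar1 n Δ₁ *ᵥ δ) with hD
  have hD0 : 0 ≤ D := dotProduct_self_nonneg' _
  have hM0 := dotProduct_self_nonneg' (Δ₂ *ᵥ δ)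
  set b := 2 * c₁ / Real.sqrt (c₂ * ι₃l) with hb
  have hb0 : 0 < b := by positivity
  have hb2 : b ^ 2 = 4 * c₁ ^ 2 / (c₂ * ι₃l) := by
    rw [hb, div_pow, Real.sq_sqrt (by positivity)]; ring
  have hquad : ∀ s : ℝ, 0 ≤ (γ - 1) * (δ ⬝ᵥ δ) - c₁ * ((Δ₂ *ᵥ δ) ⬝ᵥ (Δ₂ *ᵥ δ)) -
      2 * b * s * D + γ₂ * s ^ 2 * D := by
    intro s
    have h1 := h.quadratic_form_nonneg 0 (W *ᵥ δ) δ (-s • (deltaBar1 n Δ₁ *ᵥ δ))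
    rw [dotProduct_phi44_mulVec, hWδ, ← hD, ← hb] at h1
    simp only [Matrix.mulVec_zero, dotProduct_zero, mul_zero, smul_dotProduct, dotProduct_smul,
      smul_eq_mul, ← hD] at h1
    have h2 : 0 ≤ 8 * c₂ * ι₃u ^ 2 / ι₃l * D := by positivity
    have h3 : 0 ≤ 8 * c₂ * ι₃u ^ 2 * r₄ * γ₁ / ι₃l * ((Δ₂ *ᵥ δ) ⬝ᵥ (Δ₂ *ᵥ δ)) := by positivity
    nlinarith
  rcases hγ₂.eq_or_lt with h0 | hpos
  · have hDz : D = 0 := by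
      by_contra hne
      have hDpos : 0 < D := lt_of_le_of_ne hD0 (Ne.symm hne)
      set K := (γ - 1) * (δ ⬝ᵥ δ) - c₁ * ((Δ₂ *ᵥ δ) ⬝ᵥ (Δ₂ *ᵥ δ)) with hK
      have h1 := hquad ((K + 1) / (2 * b * D))
      rw [← h0] at h1
      have h2 : 2 * b * ((K + 1) / (2 * b * D)) * D = K + 1 := by field_simp
      rw [h2] at h1
      linarith
    have h1 := hquad 0
    rw [hDz] at h1 ⊢
    linarith
  · have hg2 : g ^ 2 = γ₂ := hg.resolve_left hpos.ne'
    have h1 := hquad (b / γ₂)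
    have h2 : 2 * b * (b / γ₂) * D - γ₂ * (b / γ₂) ^ 2 * D = b ^ 2 / γ₂ * D := by
      field_simp; ring
    have h3 : 4 * c₁ ^ 2 / (c₂ * ι₃l * g ^ 2) * D = b ^ 2 / γ₂ * D := by
      rw [hb2, hg2, div_div]
    rw [h3]
    linarith

end LMIConsequences

/-! ### Square-integrable signals -/

section Signals

variable {ι : Type*} [Fintype ι]

theorem memLp_toLp_iff {u : ℝ → ι → ℝ} :
    MemLp (fun s => (WithLp.toLp 2 (u s) : EuclideanSpace ℝ ι)) 2
      (volume.restrict (Ici (0 : ℝ))) ↔ IsL2 u := by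
  rw [memLp_piLp_iff, IsL2, memLp_pi_iff]

theorem l2Norm_eq (u : ℝ → ι → ℝ) :
    l2Norm u = Real.sqrt (∫ s in Ici (0 : ℝ), ‖(WithLp.toLp 2 (u s) : EuclideanSpace ℝ ι)‖ ^ 2) := by
  simp only [l2Norm, sq_norm_toLp]

/-- A signal whose energy on bounded intervals is bounded by `B` is square integrable. -/
theorem memLp_of_forall_integral_le {F : Type*} [NormedAddCommGroup F] {z : ℝ → F} {B : ℝ}
    (hz : AEStronglyMeasurable z (volume.restrict (Ici (0 : ℝ))))
    (hi : ∀ τ, 0 ≤ τ → IntervalIntegrable (fun s => ‖z s‖ ^ 2) volume 0 τ)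
    (hB : ∀ τ, 0 ≤ τ → ∫ s in (0 : ℝ)..τ, ‖z s‖ ^ 2 ≤ B) :
    MemLp z 2 (volume.restrict (Ici (0 : ℝ))) ∧ ∫ s in Ici (0 : ℝ), ‖z s‖ ^ 2 ≤ B := by
  have hio : IntegrableOn (fun s => ‖z s‖ ^ 2) (Ioi (0 : ℝ)) := by
    refine integrableOn_Ioi_of_intervalIntegral_norm_bounded B 0 (l := Filter.atTop) (b := id)
      (fun τ => ?_) Filter.tendsto_id ?_
    · rcases le_total 0 τ with h | h
      · exact (intervalIntegrable_iff_integrableOn_Ioc_of_le h).1 (hi τ h)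
      · rw [id, Ioc_eq_empty (not_lt.2 h)]
        exact integrableOn_empty
    · filter_upwards [Filter.eventually_ge_atTop 0] with τ hτ
      simpa using hB τ hτ
  refine ⟨(memLp_two_iff_integrable_sq_norm hz).2 ((integrableOn_Ici_iff_integrableOn_Ioi (by simp)).2 hio), ?_⟩
  rw [integral_Ici_eq_integral_Ioi]
  refine le_of_tendsto (intervalIntegral_tendsto_integral_Ioi 0 hio Filter.tendsto_id) ?_
  filter_upwards [Filter.eventually_ge_atTop 0] with τ hτ
  exact hB τ hτ

theorem integral_le_integral_Ici {f : ℝ → ℝ} (hf : IntegrableOn f (Ici 0)) (hf0 : ∀ s, 0 ≤ f s)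
    {τ : ℝ} (hτ : 0 ≤ τ) : ∫ s in (0 : ℝ)..τ, f s ≤ ∫ s in Ici (0 : ℝ), f s := by
  rw [intervalIntegral.integral_of_le hτ]
  exact setIntegral_mono_set hf (Filter.Eventually.of_forall hf0)
    (Filter.Eventually.of_forall fun s hs => (hs.1.le : (0 : ℝ) ≤ s))

theorem l2Gain_le {κ : Type*} [Fintype κ] {H : (ℝ → ι → ℝ) → (ℝ → κ → ℝ) → Prop} {γ B : ℝ}
    (hγ : 0 ≤ γ) (hB : 0 ≤ B)
    (hH : ∀ u z, IsL2 u → H u z → IsL2 z ∧ ∫ s in Ici (0 : ℝ),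
      ‖(WithLp.toLp 2 (z s) : EuclideanSpace ℝ κ)‖ ^ 2 ≤
        γ * (∫ s in Ici (0 : ℝ), ‖(WithLp.toLp 2 (u s) : EuclideanSpace ℝ ι)‖ ^ 2) + B) :
    l2Gain H ≤ ENNReal.ofReal (Real.sqrt γ) := by
  refine iInf₂_le (Real.sqrt γ).toNNReal ⟨(Real.sqrt B).toNNReal, fun u z hu hz => ?_⟩
  obtain ⟨h1, h2⟩ := hH u z hu hz
  refine ⟨h1, ?_⟩
  rw [Real.coe_toNNReal _ (Real.sqrt_nonneg _), Real.coe_toNNReal _ (Real.sqrt_nonneg _),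
    l2Norm_eq, l2Norm_eq, ← Real.sqrt_mul hγ]
  refine (Real.sqrt_le_sqrt h2).trans (Real.sqrt_le_iff.2 ⟨by positivity, ?_⟩)
  have h3 : 0 ≤ γ * ∫ s in Ici (0 : ℝ), ‖(WithLp.toLp 2 (u s) : EuclideanSpace ℝ ι)‖ ^ 2 :=
    mul_nonneg hγ (integral_nonneg fun _ => sq_nonneg _)
  rw [add_sq, Real.sq_sqrt h3, Real.sq_sqrt hB]
  linarith [mul_nonneg (Real.sqrt_nonneg (γ *
    ∫ s in Ici (0 : ℝ), ‖(WithLp.toLp 2 (u s) : EuclideanSpace ℝ ι)‖ ^ 2)) (Real.sqrt_nonneg B)]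

end Signals

/-! ### The disturbed error dynamics as a gradient flow -/

section ErrorDynamics

variable {n N Ny r : ℕ} {α : ℝ} {Γ : Fin n → Matrix (Fin N) (Fin N) ℝ}
  {C : ℝ → Fin n → Matrix (Fin Ny) (Fin N) ℝ} {E : ℝ → Finset (Fin n × Fin n)}
  {Δ₁ : Matrix (Fin N) (Fin r) ℝ} {Δ₂ : ∀ t, Matrix (OutIdx n N Ny (E t)) (Fin r) ℝ}

/-- The gain operator. -/
noncomputable def gainCLM (Γ : Fin n → Matrix (Fin N) (Fin N) ℝ) :
    EuclideanSpace ℝ (StateIdx n N) →L[ℝ] EuclideanSpace ℝ (StateIdx n N) :=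
  matrixCLM (blockDiag Γ)

/-- The state disturbance. -/
noncomputable def stateDisturbance (n : ℕ) (Δ₁ : Matrix (Fin N) (Fin r) ℝ) (δ : ℝ → Fin r → ℝ)
    (t : ℝ) : EuclideanSpace ℝ (StateIdx n N) :=
  WithLp.toLp 2 (deltaBar1 n Δ₁ *ᵥ δ t)

/-- The output disturbance, extended by zero. -/
noncomputable def outputDisturbance (Δ₂ : ∀ t, Matrix (OutIdx n N Ny (E t)) (Fin r) ℝ)
    (δ : ℝ → Fin r → ℝ) (t : ℝ) : EuclideanSpace ℝ (FullOutIdx n N Ny) :=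
  WithLp.toLp 2 (extendByZero (Δ₂ t *ᵥ δ t))

theorem outputCLM_toLp (t : ℝ) (x : StateIdx n N → ℝ) :
    outputCLM α C E t (WithLp.toLp 2 x) =
      WithLp.toLp 2 (extendByZero (lambdaBar α (C t) (E t) *ᵥ x)) := by
  rw [outputCLM, matrixCLM_toLp, extendRows_mulVec]

theorem gainCLM_adjoint_outputCLM (t : ℝ) (u : OutIdx n N Ny (E t) → ℝ) :
    gainCLM Γ ((outputCLM α C E t).adjoint (WithLp.toLp 2 (extendByZero u))) =
      WithLp.toLp 2 ((blockDiag Γ * (lambdaBar α (C t) (E t))ᵀ) *ᵥ u) := by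
  rw [outputCLM, adjoint_matrixCLM, matrixCLM_toLp, extendRows_transpose_mulVec, gainCLM,
    matrixCLM_toLp, Matrix.mulVec_mulVec]

theorem isErrorTrajectory_iff {x₀ : StateIdx n N → ℝ} {δ : ℝ → Fin r → ℝ}
    {x : ℝ → StateIdx n N → ℝ} :
    IsErrorTrajectory α Γ C E Δ₁ Δ₂ x₀ δ x ↔
      IsPrimitive (WithLp.toLp 2 x₀ : EuclideanSpace ℝ (StateIdx n N))
        (fun s => -gainCLM Γ ((outputCLM α C E s).adjoint
            (outputCLM α C E s (WithLp.toLp 2 (x s)))) +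
          (gainCLM Γ ((outputCLM α C E s).adjoint (outputDisturbance Δ₂ δ s)) -
            stateDisturbance n Δ₁ δ s)) (fun s => WithLp.toLp 2 (x s)) := by
  have hF : ∀ s, -gainCLM Γ ((outputCLM α C E s).adjoint
            (outputCLM α C E s (WithLp.toLp 2 (x s)))) +
          (gainCLM Γ ((outputCLM α C E s).adjoint (outputDisturbance Δ₂ δ s)) -
            stateDisturbance n Δ₁ δ s) = WithLp.toLp 2
      (-((blockDiag Γ * (lambdaBar α (C s) (E s))ᵀ * lambdaBar α (C s) (E s)) *ᵥ x s) +
      (blockDiag Γ * (lambdaBar α (C s) (E s))ᵀ * Δ₂ s - deltaBar1 n Δ₁) *ᵥ δ s) := by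
    intro s
    rw [outputCLM_toLp, gainCLM_adjoint_outputCLM, outputDisturbance, gainCLM_adjoint_outputCLM,
      stateDisturbance, Matrix.sub_mulVec, Matrix.mulVec_mulVec, Matrix.mulVec_mulVec]
    rfl
  simp only [hF]
  set e := (EuclideanSpace.equiv (StateIdx n N) ℝ) with he
  constructor
  · intro h
    exact IsPrimitive.map (e.symm : (StateIdx n N → ℝ) →L[ℝ] EuclideanSpace ℝ (StateIdx n N)) h
  · intro h
    exact IsPrimitive.map (e : EuclideanSpace ℝ (StateIdx n N) →L[ℝ] (StateIdx n N → ℝ)) h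

theorem blockDiag_transpose {A : Fin n → Matrix (Fin N) (Fin N) ℝ} (hA : ∀ i, (A i)ᵀ = A i) :
    (blockDiag A)ᵀ = blockDiag A := by
  ext x y
  by_cases h : x.1 = y.1
  · have h1 := congrFun (congrFun (hA x.1) x.2) y.2
    simp only [blockDiag, Matrix.transpose_apply, Matrix.of_apply, h, if_true]
    rw [← h]
    exact h1
  · simp [blockDiag, h, Ne.symm h]

theorem gainCLM_symm (hΓ : ∀ i, (Γ i).PosDef) (u v : EuclideanSpace ℝ (StateIdx n N)) :
    inner ℝ (gainCLM Γ u) v = inner ℝ u (gainCLM Γ v) := by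
  have hT : ∀ i, (Γ i)ᵀ = Γ i := fun i => by
    rw [← Matrix.conjTranspose_eq_transpose_of_trivial]; exact (hΓ i).1
  have h : (gainCLM Γ).adjoint = gainCLM Γ := by
    rw [gainCLM, adjoint_matrixCLM, blockDiag_transpose hT]
  rw [← ContinuousLinearMap.adjoint_inner_right, h]

theorem gainCLM_pos (hΓ : ∀ i, (Γ i).PosDef) (u : EuclideanSpace ℝ (StateIdx n N)) (hu : u ≠ 0) :
    0 < inner ℝ u (gainCLM Γ u) := by
  have h1 : inner ℝ u (gainCLM Γ u) = u.ofLp ⬝ᵥ (blockDiag Γ *ᵥ u.ofLp) :=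
    inner_toLp u.ofLp (blockDiag Γ *ᵥ u.ofLp)
  have h2 : u.ofLp ⬝ᵥ (blockDiag Γ *ᵥ u.ofLp) =
      ∑ i, (fun k => u.ofLp (i, k)) ⬝ᵥ (Γ i *ᵥ fun k => u.ofLp (i, k)) := by
    rw [dotProduct, Fintype.sum_prod_type]
    simp only [blockDiag_mulVec]
    rfl
  rw [h1, h2]
  refine Finset.sum_pos' (fun i _ => ?_) ?_
  · simpa using (hΓ i).posSemidef.dotProduct_mulVec_nonneg fun k => u.ofLp (i, k)
  · by_contra! hall
    refine hu (PiLp.ext fun ⟨i, k⟩ => ?_)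
    by_contra hne
    have hne' : (fun k => u.ofLp (i, k)) ≠ 0 := fun h => hne (congrFun h k)
    have h3 := (hΓ i).dotProduct_mulVec_pos hne'
    rw [star_trivial] at h3
    exact absurd (hall i (Finset.mem_univ i)) (not_le.2 h3)

theorem mul_norm_le_norm_gainCLM {g : ℝ}
    (h : (blockDiag Γ - g • (1 : Matrix (StateIdx n N) (StateIdx n N) ℝ)).PosSemidef)
    (u : EuclideanSpace ℝ (StateIdx n N)) : g * ‖u‖ ≤ ‖gainCLM Γ u‖ := by
  rcases eq_or_ne u 0 with rfl | hu
  · simp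
  have h1 : inner ℝ u (gainCLM Γ u) = u.ofLp ⬝ᵥ (blockDiag Γ *ᵥ u.ofLp) :=
    inner_toLp u.ofLp (blockDiag Γ *ᵥ u.ofLp)
  have h2 := h.dotProduct_mulVec_nonneg u.ofLp
  rw [star_trivial, Matrix.sub_mulVec, dotProduct_sub, Matrix.smul_mulVec, Matrix.one_mulVec,
    dotProduct_smul, smul_eq_mul, ← h1, ← sq_norm_toLp u.ofLp] at h2
  have h3 := real_inner_le_norm u (gainCLM Γ u)
  have h4 : g * ‖u‖ ^ 2 ≤ ‖u‖ * ‖gainCLM Γ u‖ := by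
    have : ‖(WithLp.toLp 2 u.ofLp : EuclideanSpace ℝ (StateIdx n N))‖ = ‖u‖ := rfl
    rw [this] at h2
    linarith
  have h5 : ‖u‖ * (g * ‖u‖) ≤ ‖u‖ * ‖gainCLM Γ u‖ := by linarith
  exact le_of_mul_le_mul_left h5 (norm_pos_iff.2 hu)

theorem memLp_stateDisturbance {δ : ℝ → Fin r → ℝ} (hδ : IsL2 δ) :
    MemLp (stateDisturbance n Δ₁ δ) 2 (volume.restrict (Ici (0 : ℝ))) :=
  (matrixCLM (deltaBar1 n Δ₁)).comp_memLp' (memLp_toLp_iff.2 hδ)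

theorem sq_norm_outputDisturbance (δ : ℝ → Fin r → ℝ) (t : ℝ) :
    ‖outputDisturbance Δ₂ δ t‖ ^ 2 = (Δ₂ t *ᵥ δ t) ⬝ᵥ (Δ₂ t *ᵥ δ t) := by
  rw [outputDisturbance, sq_norm_toLp, extendByZero_dotProduct]

theorem memLp_outputDisturbance {δ : ℝ → Fin r → ℝ} (hδ : IsL2 δ)
    (hΔ₂ : ∀ y j, Measurable fun t => extendByZero (fun i => Δ₂ t i j) y) {B : ℝ}
    (hB : ∀ t, 0 ≤ t → (Δ₂ t *ᵥ δ t) ⬝ᵥ (Δ₂ t *ᵥ δ t) ≤ B * (δ t ⬝ᵥ δ t)) :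
    MemLp (outputDisturbance Δ₂ δ) 2 (volume.restrict (Ici (0 : ℝ))) := by
  have hδ' := memLp_toLp_iff.2 hδ
  have h1 : outputDisturbance Δ₂ δ = fun t => matrixCLM (extendRows (Δ₂ t))
      (WithLp.toLp 2 (δ t)) := by
    funext t
    rw [matrixCLM_toLp, extendRows_mulVec, outputDisturbance]
  have h2 : StronglyMeasurable fun t => matrixCLM (extendRows (Δ₂ t)) :=
    stronglyMeasurable_matrixCLM hΔ₂
  refine hδ'.of_le_mul (c := Real.sqrt B) ?_ ?_
  · rw [h1]
    exact (ContinuousLinearMap.id ℝ (EuclideanSpace ℝ (Fin r) →L[ℝ]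
      EuclideanSpace ℝ (FullOutIdx n N Ny))).aestronglyMeasurable_comp₂
      h2.aestronglyMeasurable hδ'.1
  · refine (ae_restrict_iff' measurableSet_Ici).2 (Filter.Eventually.of_forall fun t ht => ?_)
    have h3 := hB t ht
    rw [← sq_norm_outputDisturbance, ← sq_norm_toLp] at h3
    rw [← Real.sqrt_sq (norm_nonneg (outputDisturbance Δ₂ δ t))]
    rcases le_total 0 B with h0 | h0
    · rw [← Real.sqrt_sq (norm_nonneg (WithLp.toLp 2 (δ t))), ← Real.sqrt_mul h0]
      exact Real.sqrt_le_sqrt h3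
    · rw [Real.sqrt_eq_zero_of_nonpos (h3.trans (mul_nonpos_of_nonpos_of_nonneg h0 (sq_nonneg _)))]
      positivity

end ErrorDynamics

end ConsInn

open ConsInn in
theorem corollary4 {n N Ny r p : ℕ} (hN : 0 < N)
    (C : ℝ → Fin n → Matrix (Fin Ny) (Fin N) ℝ)
    (G : ℝ → SimpleGraph (Fin n)) (E : ℝ → Finset (Fin n × Fin n))
    (hE : ∀ t, IsOrientation (G t) (E t))
    (T ι₁u ι₁l r₂ r₃ lam : ℝ)
    (hA : ExcitationAssumption C E T ι₁u ι₁l r₂ r₃ lam)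
    (Δ₁ : Matrix (Fin N) (Fin r) ℝ)
    (Δ₂ : ∀ t, Matrix (OutIdx n N Ny (E t)) (Fin r) ℝ)
    (hΔ₂ : ∀ y j, Measurable fun t => extendByZero (fun i => Δ₂ t i j) y)
    (Q : ∀ t, Matrix (Fin p) (OutIdx n N Ny (E t)) ℝ)
    (hQ : ∀ y i, Measurable fun t => extendByZero (fun j => Q t i j) y)
    (W : Matrix (Fin p) (Fin r) ℝ)
    (hWW : Wᵀ * W = 1) (hQW : ∀ t, 0 ≤ t → (Q t)ᵀ * W = 0)
    (Γ : Fin n → Matrix (Fin N) (Fin N) ℝ) (hΓ : ∀ i, (Γ i).PosDef)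
    (α c₂ : ℝ) (hα : 0 < α) (hc₂ : 0 < c₂)
    (c₁ γ₁ γ₂ γ r₁ r₄ ι₂u ι₂l ι₃u ι₃l : ℝ)
    (hr₁ : r₁ = ‖blockDiag Γ‖) (hr₄ : r₄ = r₂ + α * r₃)
    (hι₂u : ι₂u = iota2Upper α T r₂ r₃) (hι₂l : ι₂l = iota2Lower n N α T ι₁l r₂ lam)
    (hι₃u : ι₃u = iota3Upper r₁ ι₂u ι₂l) (hι₃l : ι₃l = iota3Lower r₁ ι₂u ι₂l)
    (hγ : 0 < γ) (hγ₁₂ : 0 ≤ γ₁ - γ₂)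
    (hLMI : ∀ t, 0 ≤ t → LMIOE Δ₁ (Δ₂ t) (Q t) W T c₁ c₂ γ₁ γ₂ γ r₄ ι₃u ι₃l)
    (hΓ_upper : (Real.sqrt γ₁ • (1 : Matrix (StateIdx n N) (StateIdx n N) ℝ) -
      blockDiag Γ).PosSemidef)
    (hΓ_lower : (blockDiag Γ -
      Real.sqrt γ₂ • (1 : Matrix (StateIdx n N) (StateIdx n N) ℝ)).PosSemidef) :
    ∀ x₀ : StateIdx n N → ℝ,
      (∀ δ : ℝ → Fin r → ℝ, IsL2 δ → ∃ x, IsErrorTrajectory α Γ C E Δ₁ Δ₂ x₀ δ x) ∧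
      l2Gain (ErrorSystem α Γ C E Δ₁ Δ₂ Q W x₀) ≤ ENNReal.ofReal (Real.sqrt γ) := by
  
  intro x₀
  subst hr₁ hr₄ hι₂u hι₂l hι₃u hι₃l
  obtain ⟨i₀, -⟩ := hA.connected_on_average T le_rfl
  have hn : 0 < n := i₀.pos
  have hT := hA.T_pos
  have : Nonempty (StateIdx n N) := ⟨(⟨0, hn⟩, ⟨0, hN⟩)⟩
  have hr₄ : 0 < r₂ + α * r₃ := add_pos hA.r₂_pos (mul_pos hα hA.r₃_pos)
  set ι := iota2Lower n N α T ι₁l r₂ lam with hιdef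
  have hι : 0 < ι := iota2Lower_pos hn hα hA.lam_pos hA.ι₁l_pos
  have hL := hA.isPersistentlyExciting hE hα
  rw [← hιdef] at hL
  have hιr : ι ≤ T * (r₂ + α * r₃) := hL.le_mul
  have hιu : ι ≤ iota2Upper α T r₂ r₃ := hιr
  set ι₃ := iota3Lower ‖blockDiag Γ‖ (iota2Upper α T r₂ r₃) ι with hι₃def
  have hι₃ : 0 < ι₃ := iota3Lower_pos hι hιu
  have hγ₂ : 0 ≤ γ₂ := (hLMI 0 le_rfl).gamma2_nonneg hn hN
  have hγ₁ : 0 ≤ γ₁ := by linarith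
  obtain ⟨G', ⟨g₀, hg₀, hg₀Γ⟩, hGain⟩ := exists_isGainPair (gainCLM_symm hΓ) (gainCLM_pos hΓ)
  obtain ⟨g, hg, hgγ, hgΓ⟩ : ∃ g, 0 < g ∧ (γ₂ = 0 ∨ g ^ 2 = γ₂) ∧
      ∀ u, g * ‖u‖ ≤ ‖gainCLM Γ u‖ := by
    rcases hγ₂.eq_or_lt with h | h
    · exact ⟨g₀, hg₀, Or.inl h.symm, hg₀Γ⟩
    · exact ⟨Real.sqrt γ₂, Real.sqrt_pos.2 h, Or.inr (Real.sq_sqrt h.le),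
        mul_norm_le_norm_gainCLM hΓ_lower⟩
  obtain ⟨hgR, hpair⟩ := hGain g hgΓ
  have hR : 0 < ‖gainCLM Γ‖ := hg.trans_le hgR
  set q := c₁ - c₂ * T with hqdef
  have hc : 0 < c₂ * T := mul_pos hc₂ hT
  have hq : 0 ≤ q := by
    by_contra! hneg
    obtain ⟨v, hv⟩ := exists_ne (0 : EuclideanSpace ℝ (StateIdx n N))
    have h1 := hL.excitation T le_rfl v
    have h2 : ∫ s in (T - T)..T, ‖outputCLM α C E s v‖ ^ 2 = ∫ s in (T - T)..T, (0 : ℝ) := by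
      refine intervalIntegral.integral_congr fun s hs => ?_
      rw [sub_self, uIcc_of_le hT.le] at hs
      have h3 := (hLMI s hs.1).sq_norm_output_le (lambdaBar α (C s) (E s) *ᵥ v.ofLp)
      rw [← sq_norm_outputCLM, ← hqdef] at h3
      have h4 := dotProduct_self_nonneg' (Q s *ᵥ (lambdaBar α (C s) (E s) *ᵥ v.ofLp))
      have h5 := sq_nonneg ‖outputCLM α C E s v‖
      change ‖outputCLM α C E s v‖ ^ 2 = 0
      nlinarith
    rw [h2, intervalIntegral.integral_zero] at h1
    have h6 : 0 < ι * ‖v‖ ^ 2 := by positivity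
    linarith
  have hqc : q + c₂ * T = c₁ := by rw [hqdef]; ring
  have hc₁ : 0 < c₁ := by linarith
  have hdist : ∀ t, 0 ≤ t → ∀ u : Fin r → ℝ, c₁ * ((Δ₂ t *ᵥ u) ⬝ᵥ (Δ₂ t *ᵥ u)) +
      4 * c₁ ^ 2 / (c₂ * ι₃ * g ^ 2) * ((deltaBar1 n Δ₁ *ᵥ u) ⬝ᵥ (deltaBar1 n Δ₁ *ᵥ u)) ≤
      (γ - 1) * (u ⬝ᵥ u) := fun t ht u =>
    (hLMI t ht).disturbance_le hWW hc₁ hc₂ hι₃ hr₄.le hγ₁ hγ₂ hgγ u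
  have hd₁ : ∀ {δ : ℝ → Fin r → ℝ}, IsL2 δ →
      MemLp (stateDisturbance n Δ₁ δ) 2 (volume.restrict (Ici (0 : ℝ))) :=
    fun hδ => memLp_stateDisturbance hδ
  have hd₂ : ∀ {δ : ℝ → Fin r → ℝ}, IsL2 δ →
      MemLp (outputDisturbance Δ₂ δ) 2 (volume.restrict (Ici (0 : ℝ))) := by
    intro δ hδ
    refine memLp_outputDisturbance hδ hΔ₂ (B := (γ - 1) / c₁) fun t ht => ?_
    have h1 := hdist t ht (δ t)
    have h2 := dotProduct_self_nonneg' (deltaBar1 n Δ₁ *ᵥ δ t)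
    have h3 : 0 ≤ 4 * c₁ ^ 2 / (c₂ * ι₃ * g ^ 2) *
      ((deltaBar1 n Δ₁ *ᵥ δ t) ⬝ᵥ (deltaBar1 n Δ₁ *ᵥ δ t)) := by positivity
    rw [div_mul_eq_mul_div, le_div_iff₀ hc₁]
    linarith
  set p₀ := ‖gainCLM Γ‖ * T * (r₂ + α * r₃) / Real.sqrt 2 with hp₀def
  have hp₀ : 0 < p₀ := by positivity
  have hp₀R : p₀ ^ 2 = (‖gainCLM Γ‖ * T * (r₂ + α * r₃)) ^ 2 / 2 := by
    rw [hp₀def, div_pow, Real.sq_sqrt zero_le_two]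
  have hι₃le : ι₃ ≤ ι / (1 + p₀) ^ 2 := by
    refine iota3Lower_le hι hιu hp₀.le ?_
    have hnorm : ‖blockDiag Γ‖ = ‖gainCLM Γ‖ := rfl
    rw [hp₀R, varphi1, iota2Upper, hnorm]
    ring
  have hcoef : q * (q + c₂ * T) / (c₂ * T) * (3 * T * (1 + p₀) ^ 2 / (ι * g ^ 2)) ≤
      4 * c₁ ^ 2 / (c₂ * ι₃ * g ^ 2) := by
    have h1 : (1 + p₀) ^ 2 / ι ≤ 1 / ι₃ := by
      rw [div_le_div_iff₀ hι hι₃, one_mul, mul_comm]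
      rwa [le_div_iff₀ (by positivity)] at hι₃le
    calc _ = 3 * (q * c₁) / (c₂ * g ^ 2) * ((1 + p₀) ^ 2 / ι) := by
          rw [hqc]; field_simp
      _ ≤ 4 * (c₁ * c₁) / (c₂ * g ^ 2) * (1 / ι₃) := by
          have h2 : q ≤ c₁ := by linarith
          gcongr
          norm_num
      _ = _ := by field_simp
  refine ⟨fun δ hδ => ?_, ?_⟩
  · obtain ⟨x, hx⟩ := hL.exists_isPrimitive (gainCLM Γ)
      ((hL.memLp_feedback (gainCLM Γ) (hd₂ hδ)).sub (hd₁ hδ)) (WithLp.toLp 2 x₀)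
    exact ⟨fun t => (x t).ofLp, isErrorTrajectory_iff.2 hx⟩
  · have hV : 0 ≤ c₁ * inner ℝ (WithLp.toLp 2 x₀) (G' (WithLp.toLp 2 x₀)) :=
      mul_nonneg hc₁.le (hpair.nonneg _)
    refine l2Gain_le hγ.le hV fun δ z hδ hz => ?_
    obtain ⟨x, hx, hzx⟩ := hz
    rw [isErrorTrajectory_iff] at hx
    have hδ' := memLp_toLp_iff.2 hδ
    have hδ2 : IntegrableOn (fun s => ‖(WithLp.toLp 2 (δ s) : EuclideanSpace ℝ (Fin r))‖ ^ 2)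
      (Ici 0) := (memLp_two_iff_integrable_sq_norm hδ'.1).1 hδ'
    have hzm : AEStronglyMeasurable (fun s => (WithLp.toLp 2 (z s) : EuclideanSpace ℝ (Fin p)))
        (volume.restrict (Ici (0 : ℝ))) := by
      have hQm : StronglyMeasurable fun t => matrixCLM (extendRows (Q t)ᵀ)ᵀ :=
        stronglyMeasurable_matrixCLM fun i y => hQ y i
      have hxm := hx.continuousOn_Ici.aestronglyMeasurable (μ := volume) measurableSet_Ici
      have hym := (ContinuousLinearMap.id ℝ (EuclideanSpace ℝ (StateIdx n N) →L[ℝ]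
        EuclideanSpace ℝ (FullOutIdx n N Ny))).aestronglyMeasurable_comp₂
        hL.stronglyMeasurable.aestronglyMeasurable hxm
      have hQy := (ContinuousLinearMap.id ℝ (EuclideanSpace ℝ (FullOutIdx n N Ny) →L[ℝ]
        EuclideanSpace ℝ (Fin p))).aestronglyMeasurable_comp₂ hQm.aestronglyMeasurable hym
      refine (hQy.add ((matrixCLM W).continuous.comp_aestronglyMeasurable hδ'.1)).congr ?_
      refine (ae_restrict_iff' measurableSet_Ici).2 (Filter.Eventually.of_forall fun t ht => ?_)
      change matrixCLM (extendRows (Q t)ᵀ)ᵀ (outputCLM α C E t (WithLp.toLp 2 (x t))) +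
        matrixCLM W (WithLp.toLp 2 (δ t)) = WithLp.toLp 2 (z t)
      rw [outputCLM_toLp, matrixCLM_toLp, extendRows_transpose_transpose_mulVec, matrixCLM_toLp,
        hzx t ht]
      rfl
    have hzle : ∀ t, 0 ≤ t → ‖(WithLp.toLp 2 (z t) : EuclideanSpace ℝ (Fin p))‖ ^ 2 ≤
        q * ‖outputCLM α C E t (WithLp.toLp 2 (x t))‖ ^ 2 +
          ‖(WithLp.toLp 2 (δ t) : EuclideanSpace ℝ (Fin r))‖ ^ 2 := by
      intro t ht
      rw [sq_norm_outputCLM, sq_norm_toLp, sq_norm_toLp, hzx t ht]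
      set y := lambdaBar α (C t) (E t) *ᵥ x t
      have h1 := (hLMI t ht).sq_norm_output_le y
      have h2 : (W *ᵥ δ t) ⬝ᵥ (W *ᵥ δ t) = δ t ⬝ᵥ δ t := by
        rw [Matrix.dotProduct_mulVec, Matrix.vecMul_mulVec, hWW, Matrix.vecMul_one]
      have h3 : (Q t *ᵥ y) ⬝ᵥ (W *ᵥ δ t) = 0 := by
        rw [Matrix.dotProduct_mulVec, ← Matrix.mulVec_transpose, Matrix.mulVec_mulVec]
        have : Wᵀ * Q t = 0 := by
          rw [← Matrix.transpose_transpose (Q t), ← Matrix.transpose_mul, hQW t ht,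
            Matrix.transpose_zero]
        rw [this, Matrix.zero_mulVec, zero_dotProduct]
      rw [add_dotProduct, dotProduct_add, dotProduct_add, h2, h3,
        dotProduct_comm (W *ᵥ δ t), h3]
      linarith
    have hyi : ∀ τ, 0 ≤ τ → IntervalIntegrable
        (fun s => ‖outputCLM α C E s (WithLp.toLp 2 (x s))‖ ^ 2) volume 0 τ := fun τ hτ =>
      hL.intervalIntegrable_sq_output hτ (hx.continuousOn hτ)
    have hδi : ∀ τ, 0 ≤ τ → IntervalIntegrable
        (fun s => ‖(WithLp.toLp 2 (δ s) : EuclideanSpace ℝ (Fin r))‖ ^ 2) volume 0 τ :=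
      fun τ hτ => intervalIntegrable_sq_norm_of_memLp hδ' le_rfl hτ
    have hzi : ∀ τ, 0 ≤ τ → IntervalIntegrable
        (fun s => ‖(WithLp.toLp 2 (z s) : EuclideanSpace ℝ (Fin p))‖ ^ 2) volume 0 τ := by
      intro τ hτ
      have h1 := ((hyi τ hτ).const_mul q).add (hδi τ hτ)
      rw [intervalIntegrable_iff_integrableOn_Icc_of_le hτ] at h1 ⊢
      refine h1.mono' ((hzm.mono_measure (Measure.restrict_mono Icc_subset_Ici_self
        le_rfl)).norm.pow 2) ?_
      refine (ae_restrict_iff' measurableSet_Icc).2 (Filter.Eventually.of_forall fun s hs => ?_)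
      rw [norm_pow, norm_norm]
      exact hzle s hs.1
    have hbound : ∀ τ, 0 ≤ τ →
        ∫ s in (0 : ℝ)..τ, ‖(WithLp.toLp 2 (z s) : EuclideanSpace ℝ (Fin p))‖ ^ 2 ≤
        γ * (∫ s in Ici (0 : ℝ), ‖(WithLp.toLp 2 (δ s) : EuclideanSpace ℝ (Fin r))‖ ^ 2) +
          c₁ * inner ℝ (WithLp.toLp 2 x₀) (G' (WithLp.toLp 2 x₀)) := by
      intro τ hτ
      have h1 := intervalIntegral.integral_mono_on hτ (hzi τ hτ)
        (((hyi τ hτ).const_mul q).add (hδi τ hτ)) fun s hs => hzle s hs.1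
      rw [intervalIntegral.integral_add ((hyi τ hτ).const_mul q) (hδi τ hτ),
        intervalIntegral.integral_const_mul] at h1
      have h2 := integral_sq_output_le hL hpair hι hιr hg hgR (hd₁ hδ) (hd₂ hδ) hx hp₀ hp₀R hq hc
        hτ
      have hi₁ := intervalIntegrable_sq_norm_of_memLp (hd₁ hδ) le_rfl hτ
      have hi₂ := intervalIntegrable_sq_norm_of_memLp (hd₂ hδ) le_rfl hτ
      have h3 : ∫ s in (0 : ℝ)..τ, (c₁ * ‖outputDisturbance Δ₂ δ s‖ ^ 2 +
          4 * c₁ ^ 2 / (c₂ * ι₃ * g ^ 2) * ‖stateDisturbance n Δ₁ δ s‖ ^ 2) ≤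
          ∫ s in (0 : ℝ)..τ,
            (γ - 1) * ‖(WithLp.toLp 2 (δ s) : EuclideanSpace ℝ (Fin r))‖ ^ 2 := by
        refine intervalIntegral.integral_mono_on hτ ((hi₂.const_mul _).add (hi₁.const_mul _))
          ((hδi τ hτ).const_mul _) fun s hs => ?_
        rw [sq_norm_outputDisturbance, stateDisturbance, sq_norm_toLp, sq_norm_toLp]
        exact hdist s hs.1 (δ s)
      rw [intervalIntegral.integral_add (hi₂.const_mul _) (hi₁.const_mul _),
        intervalIntegral.integral_const_mul, intervalIntegral.integral_const_mul,
        intervalIntegral.integral_const_mul] at h3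
      have h4 : 0 ≤ ∫ s in (0 : ℝ)..τ, ‖stateDisturbance n Δ₁ δ s‖ ^ 2 :=
        intervalIntegral.integral_nonneg hτ fun _ _ => sq_nonneg _
      have h5 := mul_le_mul_of_nonneg_right hcoef h4
      have h6 := integral_le_integral_Ici hδ2 (fun _ => sq_nonneg _) hτ
      have h7 := mul_le_mul_of_nonneg_left h6 hγ.le
      rw [hqc] at h2 h5
      linarith
    obtain ⟨hzL, hzB⟩ := memLp_of_forall_integral_le hzm hzi hbound
    exact ⟨memLp_toLp_iff.1 hzL, hzB⟩
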